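/- Work over $\mathbb Z$ with trivial involution and $\epsilon=-1$; all modules are finitely generated free abelian groups and $P^*=\mathrm{Hom}(P,\mathbb Z)$. For $\rho\in \mathrm{Hom}(M,M^*)$ put $(T\rho)(x)(y)=-\rho(y)(x)$ and let $Q_{-1}(M)=\mathrm{coker}(1-T)$. A skew-quadratic form $(M,\psi)$ is a module $M$ with $\psi\in Q_{-1}(M)$; it is nonsingular if $(1+T)\psi\colon M\to M^*$ is an isomorphism. For a submodule $S\subset M$, $S^\perp$ is its annihilator with respect to $(1+T)\psi$. A Lagrangian is a direct summand $L\subset M$ with $L=L^\perp$ and $\psi|_L=0\in Q_{-1}(L)$. The hyperbolic form $H(P)$ is $P\oplus P^*$ with the class of $((x,f),(y,g))\mapsto f(y)$. A quasi-formation $(M,\psi;L,V)$ is a nonsingular skew-quadratic form $(M,\psi)$ with a Lagrangian $L$ and a direct summand $V\subset M$ of half rank. An isomorphism of quasi-formations is an isometry carrying $L$ to $L'$ and $V$ to $V'$, and stable isomorphism means isomorphism after adding trivial formations $(H(P);P,P^*)$. Let $l_3(\mathbb Z)$ be the abelian monoid (under direct sum) of stable isomorphism classes of quasi-formations modulo the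 congruence generated by $(M,\psi;K,L)\oplus(M,\psi;L,V)\sim(M,\psi;K,V)$ for Lagrangians $K,L$. An element of $l_3(\mathbb Z)$ is elementary if it is represented by $(H(K);K,\{(x,\rho(x)):x\in K\})$ for some module $K$ and some $\rho\in\mathrm{Hom}(K,K^*)$. Let $\mathcal F^{\rm zs}_2(\mathbb Z)$ be the abelian monoid (under direct sum) of skew-quadratic forms modulo the relation $v\sim v'$ if $v\oplus(P,0)\cong v'\oplus(P',0)$ for some modules $P,P'$, and let $b\colon l_3(\mathbb Z)\to\mathcal F^{\rm zs}_2(\mathbb Z)\times\mathcal F^{\rm zs}_2(\mathbb Z)$ be the monoid homomorphism $[M,\psi;L,V]\mapsto([V,\psi|_V],[V^\perp,-\psi|_{V^\perp}])$. Proposition. Every element of $l_3(\mathbb Z)$ is elementary. Moreover, $b$ is an isomorphism of $l_3(\mathbb Z)$ onto the diagonal of $\mathcal F^{\rm zs}_2(\mathbb Z)\times\mathcal F^{\rm zs}_2(\mathbb Z)$; that is, there is a monoid isomorphism $e\colon l_3(\mathbb Z)\to\mathcal F^{\rm zs}_2(\mathbb Z)$ with $b(x)=(e(x),e(x))$ for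 all $x$. -/

import Mathlib

/-
Quadratic forms, quasi-formations and the surgery obstruction monoids `l_{2q+1}(ℤ)`, `ε = (-1)^q`.

The ground ring is `ℤ` with the trivial involution.  Its reduced group
`K̃₁(ℤ) = coker (K₁(ℤ) → K₁(ℤ))` is zero, so a stably free (that is, free) finitely generated
abelian group carries exactly one equivalence class of preferred `s`-bases and every isomorphism
is simple.  Hence based modules are finitely generated free abelian groups, and
"simple form", "simple Lagrangian" and "simple isometry" mean nonsingular form, Lagrangian and
isometry.
-/

open LinearMap (BilinForm)

namespace Surgery

noncomputable section

/-! ### The groups `Q_ε(M)` -/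

section Q

variable (ε : ℤˣ) (M : Type) [AddCommGroup M]

/-- The duality involution `T_ε` on `Hom(M, M^*)`: `(T_ε φ) x y = ε φ y x`. -/
def duality : BilinForm ℤ M →ₗ[ℤ] BilinForm ℤ M where
  toFun φ := (ε : ℤ) • φ.flip
  map_add' φ φ' := by ext x y; simp
  map_smul' c φ := by ext x y; simp; ring

/-- `Q_ε(M) = coker (1 - T_ε)`. -/
abbrev Q : Type := BilinForm ℤ M ⧸ LinearMap.range (LinearMap.id - duality ε M)

variable {M}

/-- The class in `Q_ε(M)` of an asymmetric form. -/
def Q.mk : BilinForm ℤ M →ₗ[ℤ] Q ε M :=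
  Submodule.mkQ (LinearMap.range (LinearMap.id - duality ε M))

variable {ε}

theorem duality_duality (φ : BilinForm ℤ M) : duality ε M (duality ε M φ) = φ := by
  ext x y
  rcases Int.units_eq_one_or ε with h | h <;> simp [duality, h]

/-- The symmetrisation `1 + T_ε : Q_ε(M) → Hom(M, M^*)`. -/
def Q.symm : Q ε M →ₗ[ℤ] BilinForm ℤ M :=
  Submodule.liftQ (LinearMap.range (LinearMap.id - duality ε M))
    (LinearMap.id + duality ε M) (by
      rintro _ ⟨φ, rfl⟩
      simp [duality_duality])

/-- The pull-back `ψ ↦ f^* ψ f` along a homomorphism `f`. -/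
def Q.pullback {N : Type} [AddCommGroup N] (f : N →ₗ[ℤ] M) : Q ε M →ₗ[ℤ] Q ε N :=
  Submodule.mapQ (LinearMap.range (LinearMap.id - duality ε M))
    (LinearMap.range (LinearMap.id - duality ε N))
    { toFun := fun φ => φ.compl₁₂ f f
      map_add' := fun φ φ' => by ext; simp
      map_smul' := fun c φ => by ext; simp } (by
      rintro _ ⟨φ, rfl⟩
      refine ⟨φ.compl₁₂ f f, ?_⟩
      ext x y
      simp [duality])

/-- The orthogonal sum `ψ ⊕ ψ'`. -/
def Q.sum {N : Type} [AddCommGroup N] (ψ : Q ε M) (ψ' : Q ε N) : Q ε (M × N) :=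
  Q.pullback (LinearMap.fst ℤ M N) ψ + Q.pullback (LinearMap.snd ℤ M N) ψ'

theorem Q.mk_surjective (ψ : Q ε M) : ∃ ρ : BilinForm ℤ M, Q.mk ε ρ = ψ :=
  Submodule.mkQ_surjective _ ψ

@[simp] theorem Q.symm_mk (ρ : BilinForm ℤ M) (x y : M) :
    Q.symm (Q.mk ε ρ) x y = ρ x y + ε * ρ y x :=
  rfl

theorem Q.pullback_mk {N : Type} [AddCommGroup N] (f : N →ₗ[ℤ] M) (ρ : BilinForm ℤ M) :
    Q.pullback f (Q.mk ε ρ) = Q.mk ε (ρ.compl₁₂ f f) := by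
  simp [Q.pullback, Q.mk]

@[simp] theorem Q.pullback_pullback {N P : Type} [AddCommGroup N] [AddCommGroup P]
    (f : N →ₗ[ℤ] M) (g : P →ₗ[ℤ] N) (ψ : Q ε M) :
    Q.pullback g (Q.pullback f ψ) = Q.pullback (f ∘ₗ g) ψ := by
  obtain ⟨ρ, rfl⟩ := Q.mk_surjective ψ
  rw [Q.pullback_mk, Q.pullback_mk, Q.pullback_mk]
  rfl

@[simp] theorem Q.pullback_id (ψ : Q ε M) : Q.pullback LinearMap.id ψ = ψ := by
  obtain ⟨ρ, rfl⟩ := Q.mk_surjective ψ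
  rw [Q.pullback_mk]
  rfl

theorem Q.symm_pullback {N : Type} [AddCommGroup N] (f : N →ₗ[ℤ] M) (ψ : Q ε M) (x y : N) :
    Q.symm (Q.pullback f ψ) x y = Q.symm ψ (f x) (f y) := by
  obtain ⟨ρ, rfl⟩ := Q.mk_surjective ψ
  simp [Q.pullback_mk]

@[simp] theorem Q.symm_sum {N : Type} [AddCommGroup N] (ψ : Q ε M) (ψ' : Q ε N) (x y : M × N) :
    Q.symm (Q.sum ψ ψ') x y = Q.symm ψ x.1 y.1 + Q.symm ψ' x.2 y.2 := by
  simp [Q.sum, Q.symm_pullback]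

theorem Q.symm_swap (ψ : Q ε M) (x y : M) : Q.symm ψ x y = ε * Q.symm ψ y x := by
  obtain ⟨ρ, rfl⟩ := Q.mk_surjective ψ
  rcases Int.units_eq_one_or ε with rfl | rfl <;> (simp; try ring)

theorem Q.sum_pullback {N M' N' : Type} [AddCommGroup N] [AddCommGroup M'] [AddCommGroup N']
    (ψ : Q ε M) (ψ' : Q ε N) (f : M' →ₗ[ℤ] M) (g : N' →ₗ[ℤ] N) :
    Q.pullback (f.prodMap g) (Q.sum ψ ψ') = Q.sum (Q.pullback f ψ) (Q.pullback g ψ') := by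
  simp only [Q.sum, map_add, Q.pullback_pullback]
  rfl

theorem Q.sum_comm_pullback {N : Type} [AddCommGroup N] (ψ : Q ε M) (ψ' : Q ε N) :
    Q.pullback (LinearEquiv.prodComm ℤ M N).toLinearMap (Q.sum ψ' ψ) = Q.sum ψ ψ' := by
  simp only [Q.sum, map_add, Q.pullback_pullback]
  rw [add_comm]
  rfl

theorem Q.sum_assoc_pullback {N P : Type} [AddCommGroup N] [AddCommGroup P]
    (ψ : Q ε M) (ψ' : Q ε N) (ψ'' : Q ε P) :
    Q.pullback (LinearEquiv.prodAssoc ℤ M N P).toLinearMap (Q.sum ψ (Q.sum ψ' ψ'')) =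
      Q.sum (Q.sum ψ ψ') ψ'' := by
  simp only [Q.sum, map_add, Q.pullback_pullback]
  rw [← add_assoc]
  rfl

/-- The isomorphism `0 ⊕ M ≅ M`. -/
def punitProd (M : Type) [AddCommGroup M] : (PUnit.{1} × M) ≃ₗ[ℤ] M :=
  LinearEquiv.uniqueProd

theorem Q.zero_sum_pullback (ψ : Q ε M) :
    Q.pullback (punitProd M).toLinearMap ψ = Q.sum (0 : Q ε PUnit.{1}) ψ := by
  simp only [Q.sum, map_zero, zero_add]
  rfl

theorem Q.sum_zero_zero {N : Type} [AddCommGroup N] : Q.sum (0 : Q ε M) (0 : Q ε N) = 0 := by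
  simp [Q.sum]

end Q

/-! ### Forms and `0`-stabilised forms -/

/-- An `ε`-quadratic form `(V, θ)` on a finitely generated free abelian group. -/
structure Form (ε : ℤˣ) where
  carrier : Type
  [grp : AddCommGroup carrier]
  [free : Module.Free ℤ carrier]
  [fin : Module.Finite ℤ carrier]
  θ : Q ε carrier

attribute [instance] Form.grp Form.free Form.fin

namespace Form

variable {ε : ℤˣ}

/-- There is an isometry `v ≅ w`. -/
def Isometric (v w : Form ε) : Prop :=
  ∃ f : v.carrier ≃ₗ[ℤ] w.carrier, Q.pullback f.toLinearMap w.θ = v.θ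

/-- The orthogonal sum of forms. -/
def sum (v w : Form ε) : Form ε where
  carrier := v.carrier × w.carrier
  θ := Q.sum v.θ w.θ

/-- The zero form `(P, 0)`. -/
def zero (ε : ℤˣ) (P : Type) [AddCommGroup P] [Module.Free ℤ P] [Module.Finite ℤ P] : Form ε where
  carrier := P
  θ := 0

theorem Isometric.refl (v : Form ε) : Isometric v v := ⟨LinearEquiv.refl ℤ _, Q.pullback_id _⟩

theorem Isometric.symm {v w : Form ε} : Isometric v w → Isometric w v := by
  rintro ⟨f, hf⟩
  refine ⟨f.symm, ?_⟩
  rw [← hf, Q.pullback_pullback]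
  simp

theorem Isometric.trans {u v w : Form ε} : Isometric u v → Isometric v w → Isometric u w := by
  rintro ⟨f, hf⟩ ⟨g, hg⟩
  refine ⟨f.trans g, ?_⟩
  rw [← hf, ← hg, Q.pullback_pullback]
  rfl

theorem Isometric.sum {v v' w w' : Form ε} :
    Isometric v v' → Isometric w w' → Isometric (v.sum w) (v'.sum w') := by
  rintro ⟨f, hf⟩ ⟨g, hg⟩
  refine ⟨f.prodCongr g, ?_⟩
  have := Q.sum_pullback v'.θ w'.θ f.toLinearMap g.toLinearMap
  rw [hf, hg] at this
  exact this

theorem isometric_sum_comm (v w : Form ε) : Isometric (v.sum w) (w.sum v) := by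
  exact ⟨LinearEquiv.prodComm ℤ v.carrier w.carrier, Q.sum_comm_pullback v.θ w.θ⟩

theorem isometric_sum_assoc (u v w : Form ε) :
    Isometric ((u.sum v).sum w) (u.sum (v.sum w)) := by
  exact ⟨LinearEquiv.prodAssoc ℤ u.carrier v.carrier w.carrier, Q.sum_assoc_pullback u.θ v.θ w.θ⟩

theorem isometric_zero_sum (v : Form ε) : Isometric ((zero ε PUnit).sum v) v := by
  exact ⟨punitProd v.carrier, Q.zero_sum_pullback v.θ⟩

instance isoSetoid (ε : ℤˣ) : Setoid (Form ε) where
  r := Isometric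
  iseqv := ⟨Isometric.refl, Isometric.symm, Isometric.trans⟩

/-- Isometry classes of `ε`-quadratic forms. -/
def IsoClass (ε : ℤˣ) : Type 1 := Quotient (isoSetoid ε)

/-- The isometry class of a form. -/
def isoClass (v : Form ε) : IsoClass ε := Quotient.mk _ v

instance : Add (IsoClass ε) :=
  ⟨Quotient.map₂ Form.sum fun _ _ h _ _ h' => Isometric.sum h h'⟩

instance : Zero (IsoClass ε) := ⟨isoClass (zero ε PUnit)⟩

/-- The monoid of isometry classes under orthogonal sum. -/
instance : AddCommMonoid (IsoClass ε) where
  add_assoc := by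
    rintro ⟨a⟩ ⟨b⟩ ⟨c⟩
    exact Quotient.sound (isometric_sum_assoc a b c)
  zero_add := by
    rintro ⟨a⟩
    exact Quotient.sound (isometric_zero_sum a)
  add_zero := by
    rintro ⟨a⟩
    exact Quotient.sound ((isometric_sum_comm _ _).trans (isometric_zero_sum a))
  add_comm := by
    rintro ⟨a⟩ ⟨b⟩
    exact Quotient.sound (isometric_sum_comm a b)
  nsmul := nsmulRec

theorem isoClass_sum (v w : Form ε) : isoClass (v.sum w) = isoClass v + isoClass w := rfl

theorem isoClass_zero_prod (P P' : Type) [AddCommGroup P] [Module.Free ℤ P] [Module.Finite ℤ P]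
    [AddCommGroup P'] [Module.Free ℤ P'] [Module.Finite ℤ P'] :
    isoClass (zero ε P) + isoClass (zero ε P') = isoClass (zero ε (P × P')) := by
  have h : Q.sum (0 : Q ε P) (0 : Q ε P') = 0 := Q.sum_zero_zero
  exact congrArg isoClass (congrArg (fun θ => (⟨P × P', θ⟩ : Form ε)) h)

/-- `0`-stable equivalence: `v ⊕ (P, 0) ≅ w ⊕ (P', 0)` for some `P` and `P'`. -/
def zeroStable (ε : ℤˣ) : AddCon (IsoClass ε) where
  r a b := ∃ (P P' : Type) (_ : AddCommGroup P) (_ : Module.Free ℤ P) (_ : Module.Finite ℤ P)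
    (_ : AddCommGroup P') (_ : Module.Free ℤ P') (_ : Module.Finite ℤ P'),
    a + isoClass (zero ε P) = b + isoClass (zero ε P')
  iseqv := by
    refine ⟨fun a => ⟨PUnit, PUnit, inferInstance, inferInstance, inferInstance, inferInstance,
      inferInstance, inferInstance, rfl⟩, ?_, ?_⟩
    · rintro a b ⟨P, P', _, _, _, _, _, _, h⟩
      exact ⟨P', P, inferInstance, inferInstance, inferInstance, inferInstance,
        inferInstance, inferInstance, h.symm⟩
    · rintro a b c ⟨P, P', _, _, _, _, _, _, h⟩ ⟨R, R', _, _, _, _, _, _, h'⟩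
      refine ⟨P × R, P' × R', inferInstance, inferInstance, inferInstance, inferInstance,
        inferInstance, inferInstance, ?_⟩
      rw [← isoClass_zero_prod, ← isoClass_zero_prod, ← add_assoc, h, add_right_comm, h']
      abel
  add' := by
    rintro a b c d ⟨P, P', _, _, _, _, _, _, h⟩ ⟨R, R', _, _, _, _, _, _, h'⟩
    refine ⟨P × R, P' × R', inferInstance, inferInstance, inferInstance, inferInstance,
      inferInstance, inferInstance, ?_⟩
    rw [← isoClass_zero_prod, ← isoClass_zero_prod, add_add_add_comm, h, h', add_add_add_comm]

end Form

/-- The monoid `F^{zs}_{2q}(ℤ)` of `0`-stabilised `ε`-quadratic forms, `ε = (-1)^q`. -/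
abbrev FZS (ε : ℤˣ) : Type 1 := (Form.zeroStable ε).Quotient

/-- The `0`-stabilised form `[V, θ]`. -/
def Form.toFZS {ε : ℤˣ} (v : Form ε) : FZS ε := ((v.isoClass : Form.IsoClass ε) : FZS ε)

theorem Form.toFZS_sum {ε : ℤˣ} (v w : Form ε) : (v.sum w).toFZS = v.toFZS + w.toFZS := rfl

theorem Form.toFZS_congr {ε : ℤˣ} {v w : Form ε} (h : Isometric v w) : v.toFZS = w.toFZS :=
  congrArg (fun a : Form.IsoClass ε => (a : FZS ε)) (Quotient.sound h)

theorem Form.toFZS_zero {ε : ℤˣ} (v : Form ε) (h : v.θ = 0) : v.toFZS = 0 := by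
  refine (AddCon.eq _).2 ⟨PUnit, v.carrier, inferInstance, inferInstance, inferInstance,
    inferInstance, inferInstance, inferInstance, ?_⟩
  have h1 : v.isoClass = Form.isoClass (Form.zero ε v.carrier) := by
    obtain ⟨V, θ⟩ := v
    obtain rfl : θ = 0 := h
    rfl
  rw [h1, add_comm]
  rfl

/-! ### Quasi-formations -/

section Sub

variable {ε : ℤˣ} {M : Type} [AddCommGroup M]

/-- The annihilator `L^⊥` of a submodule. -/
def annihilator (ψ : Q ε M) (L : Submodule ℤ M) : Submodule ℤ M where
  carrier := {x | ∀ y ∈ L, Q.symm ψ x y = 0}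
  add_mem' := fun ha hb y hy => by simp [ha y hy, hb y hy]
  zero_mem' := fun y _ => by simp
  smul_mem' := fun c x hx y hy => by simp [hx y hy]

/-- `L` is a direct summand. -/
def IsSummand (L : Submodule ℤ M) : Prop := ∃ L' : Submodule ℤ M, IsCompl L L'

/-- `L` is a Lagrangian: a direct summand with `L = L^⊥` on which the quadratic form vanishes. -/
structure IsLagrangian (ψ : Q ε M) (L : Submodule ℤ M) : Prop where
  summand : IsSummand L
  annihilator_eq : annihilator ψ L = L
  pullback_eq : Q.pullback L.subtype ψ = 0

theorem annihilator_prod {N : Type} [AddCommGroup N] (ψ : Q ε M) (ψ' : Q ε N)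
    (S : Submodule ℤ M) (S' : Submodule ℤ N) :
    annihilator (Q.sum ψ ψ') (S.prod S') = (annihilator ψ S).prod (annihilator ψ' S') := by
  ext ⟨x, x'⟩
  constructor
  · intro h
    constructor
    · intro y hy
      have := h (y, 0) ⟨hy, S'.zero_mem⟩
      simpa using this
    · intro y hy
      have := h (0, y) ⟨S.zero_mem, hy⟩
      simpa using this
  · rintro ⟨h, h'⟩ ⟨y, y'⟩ ⟨hy, hy'⟩
    have h1 : Q.symm ψ x y = 0 := h y hy
    have h2 : Q.symm ψ' x' y' = 0 := h' y' hy'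
    simp [h1, h2]

theorem annihilator_map {N : Type} [AddCommGroup N] (ψ : Q ε N) (f : M ≃ₗ[ℤ] N)
    (S : Submodule ℤ M) :
    annihilator ψ (S.map f.toLinearMap) =
      (annihilator (Q.pullback f.toLinearMap ψ) S).map f.toLinearMap := by
  ext x
  obtain ⟨x, rfl⟩ := f.surjective x
  constructor
  · intro h
    refine ⟨x, fun y hy => ?_, rfl⟩
    rw [Q.symm_pullback]
    exact h _ ⟨y, hy, rfl⟩
  · rintro ⟨z, hz, hzx⟩ _ ⟨y, hy, rfl⟩
    have := hz y hy
    rw [Q.symm_pullback, hzx] at this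
    exact this

theorem IsSummand.prod {N : Type} [AddCommGroup N] {S : Submodule ℤ M} {S' : Submodule ℤ N} :
    IsSummand S → IsSummand S' → IsSummand (S.prod S') := by
  rintro ⟨C, hC⟩ ⟨C', hC'⟩
  refine ⟨C.prod C', ?_, ?_⟩
  · rw [disjoint_iff, Submodule.prod_inf_prod, hC.inf_eq_bot, hC'.inf_eq_bot, Submodule.prod_bot]
  · rw [codisjoint_iff, Submodule.prod_sup_prod, hC.sup_eq_top, hC'.sup_eq_top,
      Submodule.prod_top]

/-- The projections `S ⊕ S' → S` and `S ⊕ S' → S'` form an isomorphism. -/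
def prodSub {N : Type} [AddCommGroup N] (S : Submodule ℤ M) (S' : Submodule ℤ N) :
    (S.prod S') ≃ₗ[ℤ] S × S' where
  toFun x := (⟨x.1.1, x.2.1⟩, ⟨x.1.2, x.2.2⟩)
  invFun y := ⟨(y.1.1, y.2.1), y.1.2, y.2.2⟩
  map_add' _ _ := rfl
  map_smul' _ _ := rfl

theorem pullback_prodSub {N : Type} [AddCommGroup N] (ψ : Q ε M) (ψ' : Q ε N)
    (S : Submodule ℤ M) (S' : Submodule ℤ N) :
    Q.pullback (prodSub S S').toLinearMap
        (Q.sum (Q.pullback S.subtype ψ) (Q.pullback S'.subtype ψ')) =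
      Q.pullback (S.prod S').subtype (Q.sum ψ ψ') := by
  simp only [Q.sum, map_add, Q.pullback_pullback]
  rfl

theorem IsLagrangian.prod {N : Type} [AddCommGroup N] {ψ : Q ε M} {ψ' : Q ε N}
    {S : Submodule ℤ M} {S' : Submodule ℤ N} (h : IsLagrangian ψ S) (h' : IsLagrangian ψ' S') :
    IsLagrangian (Q.sum ψ ψ') (S.prod S') where
  summand := h.summand.prod h'.summand
  annihilator_eq := by rw [annihilator_prod, h.annihilator_eq, h'.annihilator_eq]
  pullback_eq := by
    rw [← pullback_prodSub, h.pullback_eq, h'.pullback_eq, Q.sum_zero_zero, map_zero]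

theorem nonsingular_sum {N : Type} [AddCommGroup N] {ψ : Q ε M} {ψ' : Q ε N}
    (h : Function.Bijective (Q.symm ψ : M →ₗ[ℤ] Module.Dual ℤ M))
    (h' : Function.Bijective (Q.symm ψ' : N →ₗ[ℤ] Module.Dual ℤ N)) :
    Function.Bijective (Q.symm (Q.sum ψ ψ') : M × N →ₗ[ℤ] Module.Dual ℤ (M × N)) := by
  constructor
  · rw [injective_iff_map_eq_zero]
    rintro ⟨x, x'⟩ hx
    have h1 : x = 0 := by
      refine (injective_iff_map_eq_zero _).1 h.1 x (LinearMap.ext fun y => ?_)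
      simpa using LinearMap.congr_fun hx (y, 0)
    have h2 : x' = 0 := by
      refine (injective_iff_map_eq_zero _).1 h'.1 x' (LinearMap.ext fun y => ?_)
      simpa using LinearMap.congr_fun hx (0, y)
    rw [h1, h2]
    rfl
  · intro g
    obtain ⟨x, hx⟩ := h.2 (g ∘ₗ LinearMap.inl ℤ M N)
    obtain ⟨x', hx'⟩ := h'.2 (g ∘ₗ LinearMap.inr ℤ M N)
    refine ⟨(x, x'), LinearMap.ext fun y => ?_⟩
    rw [Q.symm_sum, hx, hx']
    simp only [LinearMap.comp_apply, LinearMap.inl_apply, LinearMap.inr_apply]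
    rw [← map_add]
    simp

theorem IsLagrangian.half_rank [Module.Free ℤ M] [Module.Finite ℤ M] {ψ : Q ε M}
    {L : Submodule ℤ M} (h : IsLagrangian ψ L)
    (hψ : Function.Bijective (Q.symm ψ : M →ₗ[ℤ] Module.Dual ℤ M)) :
    2 * Module.finrank ℤ L = Module.finrank ℤ M := by
  let r : M →ₗ[ℤ] Module.Dual ℤ L := (Module.Dual.transpose L.subtype) ∘ₗ Q.symm ψ
  have hker : LinearMap.ker r = L := by
    refine Eq.trans (Submodule.ext fun x => ?_) h.annihilator_eq
    rw [LinearMap.mem_ker]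
    constructor
    · intro hx y hy
      exact LinearMap.congr_fun hx ⟨y, hy⟩
    · intro hx
      ext ⟨y, hy⟩
      exact hx y hy
  have hsurj : Function.Surjective r := by
    intro g
    obtain ⟨C, hC⟩ := h.summand
    obtain ⟨x, hx⟩ := hψ.2 (g ∘ₗ L.projectionOnto C hC)
    refine ⟨x, LinearMap.ext fun y => ?_⟩
    have := LinearMap.congr_fun hx (y : M)
    change Q.symm ψ x (y : M) = g y
    rw [this]
    simp
  have e := Submodule.finrank_quotient_add_finrank (LinearMap.ker r)
  rw [(r.quotKerEquivOfSurjective hsurj).finrank_eq, hker, Module.finrank_linearMap_self] at e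
  omega

end Sub

/-- An `ε`-quadratic quasi-formation `(M, ψ; L, V)`: a nonsingular `ε`-quadratic form on a finitely
generated free abelian group, a Lagrangian `L` and a half rank direct summand `V`. -/
structure QuasiFormation (ε : ℤˣ) where
  M : Type
  [grp : AddCommGroup M]
  [free : Module.Free ℤ M]
  [fin : Module.Finite ℤ M]
  ψ : Q ε M
  nonsingular : Function.Bijective (Q.symm ψ : M →ₗ[ℤ] Module.Dual ℤ M)
  L : Submodule ℤ M
  lagrangian : IsLagrangian ψ L
  V : Submodule ℤ M
  summand : IsSummand V
  half_rank : 2 * Module.finrank ℤ V = Module.finrank ℤ M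

attribute [instance] QuasiFormation.grp QuasiFormation.free QuasiFormation.fin


/-! ### Hyperbolic forms -/

section Hyperbolic

variable (ε : ℤˣ) (P : Type) [AddCommGroup P]

/-- The asymmetric form `((x, f), (y, g)) ↦ f y` on `P ⊕ P^*`. -/
def hyperbolicPairing : BilinForm ℤ (P × Module.Dual ℤ P) :=
  LinearMap.mk₂ ℤ (fun a b => a.2 b.1) (by simp) (by simp) (by simp) (by simp)

/-- The quadratic structure of the hyperbolic form `H_ε(P)` on `P ⊕ P^*`. -/
def hyperbolic : Q ε (P × Module.Dual ℤ P) := Q.mk ε (hyperbolicPairing P)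

/-- The submodule `P ⊕ 0` of `P ⊕ P^*`. -/
def hypL : Submodule ℤ (P × Module.Dual ℤ P) := (⊤ : Submodule ℤ P).prod ⊥

/-- The submodule `0 ⊕ P^*` of `P ⊕ P^*`. -/
def hypR : Submodule ℤ (P × Module.Dual ℤ P) := (⊥ : Submodule ℤ P).prod ⊤

variable {ε P}

theorem symm_hyperbolic (a b : P × Module.Dual ℤ P) :
    Q.symm (hyperbolic ε P) a b = a.2 b.1 + ε * b.2 a.1 := rfl

theorem hyperbolic_nonsingular [Module.Free ℤ P] [Module.Finite ℤ P] :
    Function.Bijective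
      (Q.symm (hyperbolic ε P) : P × Module.Dual ℤ P →ₗ[ℤ] Module.Dual ℤ (P × Module.Dual ℤ P)) := by
  have hε : (ε : ℤ) * ε = 1 := by rcases Int.units_eq_one_or ε with rfl | rfl <;> simp
  constructor
  · rw [injective_iff_map_eq_zero]
    rintro ⟨x, f⟩ h
    have h1 : f = 0 := by
      ext y
      have := LinearMap.congr_fun h (y, 0)
      rw [symm_hyperbolic] at this
      simpa using this
    have h2 : x = 0 := by
      refine (Module.forall_dual_apply_eq_zero_iff ℤ x).1 fun g => ?_
      have := LinearMap.congr_fun h (0, g)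
      rw [symm_hyperbolic] at this
      simpa using this
    rw [h1, h2]
    rfl
  · intro h
    obtain ⟨x, hx⟩ := (Module.evalEquiv ℤ P).surjective (h ∘ₗ LinearMap.inr ℤ P (Module.Dual ℤ P))
    refine ⟨((ε : ℤ) • x, h ∘ₗ LinearMap.inl ℤ P (Module.Dual ℤ P)), ?_⟩
    refine LinearMap.ext fun b => ?_
    have hb := LinearMap.congr_fun hx b.2
    simp only [Module.evalEquiv_apply, Module.Dual.eval_apply, LinearMap.comp_apply,
      LinearMap.inr_apply] at hb
    rw [symm_hyperbolic]
    simp only [LinearMap.comp_apply, LinearMap.inl_apply, map_smul, smul_eq_mul]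
    rw [← mul_assoc, hε, one_mul, hb, ← map_add]
    simp

theorem isCompl_hyp : IsCompl (hypL P) (hypR P) := by
  constructor
  · rw [Submodule.disjoint_def]
    rintro ⟨x, f⟩ ⟨_, h1⟩ ⟨h2, _⟩
    simp_all
  · rw [codisjoint_iff, eq_top_iff]
    rintro ⟨x, f⟩ -
    refine Submodule.mem_sup.2 ⟨(x, 0), ⟨trivial, rfl⟩, (0, f), ⟨rfl, trivial⟩, by simp⟩

theorem hypL_lagrangian [Module.Free ℤ P] [Module.Finite ℤ P] :
    IsLagrangian (hyperbolic ε P) (hypL P) where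
  summand := ⟨_, isCompl_hyp⟩
  annihilator_eq := by
    ext ⟨x, f⟩
    constructor
    · intro h
      refine ⟨trivial, ?_⟩
      change f = 0
      ext y
      have := h (y, 0) ⟨trivial, rfl⟩
      rw [symm_hyperbolic] at this
      simpa using this
    · rintro ⟨-, h⟩ ⟨y, g⟩ ⟨-, h'⟩
      obtain rfl : f = 0 := h
      obtain rfl : g = 0 := h'
      rw [symm_hyperbolic]
      simp
  pullback_eq := by
    have h0 : (hyperbolicPairing P).compl₁₂ (hypL P).subtype (hypL P).subtype = 0 := by
      ext ⟨⟨x, f⟩, -, h⟩ ⟨⟨y, g⟩, -, h'⟩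
      obtain rfl : f = 0 := h
      rfl
    rw [hyperbolic, Q.pullback_mk, h0, map_zero]

theorem hypR_lagrangian [Module.Free ℤ P] [Module.Finite ℤ P] :
    IsLagrangian (hyperbolic ε P) (hypR P) where
  summand := ⟨_, isCompl_hyp.symm⟩
  annihilator_eq := by
    ext ⟨x, f⟩
    constructor
    · intro h
      refine ⟨?_, trivial⟩
      refine (Module.forall_dual_apply_eq_zero_iff ℤ x).1 fun g => ?_
      have := h (0, g) ⟨rfl, trivial⟩
      rw [symm_hyperbolic] at this
      simpa using this
    · rintro ⟨h, -⟩ ⟨y, g⟩ ⟨h', -⟩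
      obtain rfl : x = 0 := h
      obtain rfl : y = 0 := h'
      rw [symm_hyperbolic]
      simp
  pullback_eq := by
    have h0 : (hyperbolicPairing P).compl₁₂ (hypR P).subtype (hypR P).subtype = 0 := by
      ext ⟨⟨x, f⟩, h, -⟩ ⟨⟨y, g⟩, h', -⟩
      obtain rfl : y = 0 := h'
      change f 0 = 0
      simp
    rw [hyperbolic, Q.pullback_mk, h0, map_zero]

theorem isCompl_graph (ρ : P →ₗ[ℤ] Module.Dual ℤ P) :
    IsCompl (LinearMap.graph ρ) (hypR P) := by
  constructor
  · rw [Submodule.disjoint_def]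
    rintro ⟨x, f⟩ h1 ⟨h2, _⟩
    obtain rfl : x = 0 := h2
    rw [LinearMap.mem_graph_iff] at h1
    simpa using h1
  · rw [codisjoint_iff, eq_top_iff]
    rintro ⟨x, f⟩ -
    refine Submodule.mem_sup.2 ⟨(x, ρ x), by simp, (0, f - ρ x), ⟨rfl, trivial⟩, by simp⟩

theorem finrank_hyp [Module.Free ℤ P] [Module.Finite ℤ P] :
    Module.finrank ℤ (P × Module.Dual ℤ P) = 2 * Module.finrank ℤ P := by
  rw [Module.finrank_prod, Module.finrank_linearMap_self]
  ring

theorem finrank_graph (ρ : P →ₗ[ℤ] Module.Dual ℤ P) :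
    Module.finrank ℤ (LinearMap.graph ρ) = Module.finrank ℤ P := by
  rw [LinearMap.graph_eq_range_prod]
  refine (LinearEquiv.ofInjective (LinearMap.id.prod ρ) fun x y h => ?_).finrank_eq.symm
  exact congrArg Prod.fst h

end Hyperbolic

namespace QuasiFormation

variable {ε : ℤˣ}

/-- There is an isomorphism of quasi-formations `x ≅ y`. -/
def Iso (x y : QuasiFormation ε) : Prop :=
  ∃ f : x.M ≃ₗ[ℤ] y.M, Q.pullback f.toLinearMap y.ψ = x.ψ ∧
    x.L.map f.toLinearMap = y.L ∧ x.V.map f.toLinearMap = y.V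

/-- The direct sum of quasi-formations. -/
def sum (x y : QuasiFormation ε) : QuasiFormation ε where
  M := x.M × y.M
  ψ := Q.sum x.ψ y.ψ
  nonsingular := nonsingular_sum x.nonsingular y.nonsingular
  L := x.L.prod y.L
  lagrangian := x.lagrangian.prod y.lagrangian
  V := x.V.prod y.V
  summand := x.summand.prod y.summand
  half_rank := by
    rw [(prodSub x.V y.V).finrank_eq, Module.finrank_prod, Module.finrank_prod, mul_add,
      x.half_rank, y.half_rank]

/-- The trivial formation `(H_ε(P); P, P^*)`. -/
def trivialFormation (ε : ℤˣ) (P : Type) [AddCommGroup P] [Module.Free ℤ P] [Module.Finite ℤ P] :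
    QuasiFormation ε where
  M := P × Module.Dual ℤ P
  ψ := hyperbolic ε P
  nonsingular := hyperbolic_nonsingular
  L := hypL P
  lagrangian := hypL_lagrangian
  V := hypR P
  summand := (hypR_lagrangian (ε := ε)).summand
  half_rank := (hypR_lagrangian (ε := ε)).half_rank hyperbolic_nonsingular

/-- The boundary `(H_ε(K); K, {(x, ρ x)})` of an asymmetric form `(K, ρ)`. -/
def boundary (ε : ℤˣ) (K : Type) [AddCommGroup K] [Module.Free ℤ K] [Module.Finite ℤ K]
    (ρ : BilinForm ℤ K) : QuasiFormation ε where
  M := K × Module.Dual ℤ K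
  ψ := hyperbolic ε K
  nonsingular := hyperbolic_nonsingular
  L := hypL K
  lagrangian := hypL_lagrangian
  V := LinearMap.graph ρ
  summand := ⟨_, isCompl_graph ρ⟩
  half_rank := by rw [finrank_hyp, finrank_graph]

/-- The quasi-formation `(M, ψ; K, V)` obtained from `x = (M, ψ; L, V)` and a Lagrangian `K`. -/
def replaceL (x : QuasiFormation ε) (K : Submodule ℤ x.M) (hK : IsLagrangian x.ψ K) :
    QuasiFormation ε :=
  { x with L := K, lagrangian := hK }

/-- The formation `(M, ψ; K, L)` obtained from `x = (M, ψ; L, V)` and a Lagrangian `K`. -/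
def formation (x : QuasiFormation ε) (K : Submodule ℤ x.M) (hK : IsLagrangian x.ψ K) :
    QuasiFormation ε :=
  { x with
    L := K
    lagrangian := hK
    V := x.L
    summand := x.lagrangian.summand
    half_rank := x.lagrangian.half_rank x.nonsingular }

theorem Iso.refl (x : QuasiFormation ε) : Iso x x :=
  ⟨LinearEquiv.refl ℤ _, Q.pullback_id _, Submodule.map_id _, Submodule.map_id _⟩

theorem Iso.symm {x y : QuasiFormation ε} : Iso x y → Iso y x := by
  rintro ⟨f, hf, hL, hV⟩
  refine ⟨f.symm, ?_, ?_, ?_⟩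
  · rw [← hf, Q.pullback_pullback]
    simp
  · rw [← hL, ← Submodule.map_comp]
    simp
  · rw [← hV, ← Submodule.map_comp]
    simp

theorem Iso.trans {x y z : QuasiFormation ε} : Iso x y → Iso y z → Iso x z := by
  rintro ⟨f, hf, hL, hV⟩ ⟨g, hg, hL', hV'⟩
  refine ⟨f.trans g, ?_, ?_, ?_⟩
  · rw [← hf, ← hg, Q.pullback_pullback]
    rfl
  · rw [← hL', ← hL, ← Submodule.map_comp]
    rfl
  · rw [← hV', ← hV, ← Submodule.map_comp]
    rfl

theorem map_prodCongr {A B A' B' : Type} [AddCommGroup A] [AddCommGroup B] [AddCommGroup A']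
    [AddCommGroup B'] (f : A ≃ₗ[ℤ] A') (g : B ≃ₗ[ℤ] B') (S : Submodule ℤ A) (S' : Submodule ℤ B) :
    (S.prod S').map (f.prodCongr g).toLinearMap =
      (S.map f.toLinearMap).prod (S'.map g.toLinearMap) := by
  ext ⟨a, b⟩
  constructor
  · rintro ⟨⟨x, y⟩, ⟨hx, hy⟩, h⟩
    cases h
    exact ⟨⟨x, hx, rfl⟩, ⟨y, hy, rfl⟩⟩
  · rintro ⟨⟨x, hx, rfl⟩, ⟨y, hy, rfl⟩⟩
    exact ⟨(x, y), ⟨hx, hy⟩, rfl⟩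

theorem Iso.sum {x x' y y' : QuasiFormation ε} :
    Iso x x' → Iso y y' → Iso (x.sum y) (x'.sum y') := by
  rintro ⟨f, hf, hL, hV⟩ ⟨g, hg, hL', hV'⟩
  refine ⟨f.prodCongr g, ?_, ?_, ?_⟩
  · have := Q.sum_pullback x'.ψ y'.ψ f.toLinearMap g.toLinearMap
    rw [hf, hg] at this
    exact this
  · have := map_prodCongr f g x.L y.L
    rw [hL, hL'] at this
    exact this
  · have := map_prodCongr f g x.V y.V
    rw [hV, hV'] at this
    exact this

theorem map_prodComm {A B : Type} [AddCommGroup A] [AddCommGroup B]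
    (S : Submodule ℤ A) (S' : Submodule ℤ B) :
    (S.prod S').map (LinearEquiv.prodComm ℤ A B).toLinearMap = S'.prod S := by
  ext ⟨a, b⟩
  constructor
  · rintro ⟨⟨x, y⟩, ⟨hx, hy⟩, h⟩
    cases h
    exact ⟨hy, hx⟩
  · rintro ⟨hb, ha⟩
    exact ⟨(b, a), ⟨ha, hb⟩, rfl⟩

theorem map_prodAssoc {A B C : Type} [AddCommGroup A] [AddCommGroup B] [AddCommGroup C]
    (S : Submodule ℤ A) (S' : Submodule ℤ B) (S'' : Submodule ℤ C) :
    ((S.prod S').prod S'').map (LinearEquiv.prodAssoc ℤ A B C).toLinearMap =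
      S.prod (S'.prod S'') := by
  ext ⟨a, b, c⟩
  constructor
  · rintro ⟨⟨⟨x, y⟩, z⟩, ⟨⟨hx, hy⟩, hz⟩, h⟩
    cases h
    exact ⟨hx, hy, hz⟩
  · rintro ⟨ha, hb, hc⟩
    exact ⟨((a, b), c), ⟨⟨ha, hb⟩, hc⟩, rfl⟩

theorem iso_sum_comm (x y : QuasiFormation ε) : Iso (x.sum y) (y.sum x) :=
  ⟨LinearEquiv.prodComm ℤ x.M y.M, Q.sum_comm_pullback x.ψ y.ψ, map_prodComm x.L y.L,
    map_prodComm x.V y.V⟩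

theorem iso_sum_assoc (x y z : QuasiFormation ε) :
    Iso ((x.sum y).sum z) (x.sum (y.sum z)) :=
  ⟨LinearEquiv.prodAssoc ℤ x.M y.M z.M, Q.sum_assoc_pullback x.ψ y.ψ z.ψ,
    map_prodAssoc x.L y.L z.L, map_prodAssoc x.V y.V z.V⟩

/-- Swapping the middle factors of `(P ⊕ P^*) ⊕ (R ⊕ R^*)` gives `(P ⊕ R) ⊕ (P ⊕ R)^*`. -/
def hypProd (P R : Type) [AddCommGroup P] [AddCommGroup R] :
    ((P × Module.Dual ℤ P) × (R × Module.Dual ℤ R)) ≃ₗ[ℤ] ((P × R) × Module.Dual ℤ (P × R)) where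
  toFun a := ((a.1.1, a.2.1), a.1.2.coprod a.2.2)
  invFun b := ((b.1.1, b.2 ∘ₗ LinearMap.inl ℤ P R), (b.1.2, b.2 ∘ₗ LinearMap.inr ℤ P R))
  map_add' a b := by ext <;> simp
  map_smul' c a := by ext <;> simp
  left_inv a := by ext <;> simp
  right_inv b := by ext <;> simp

theorem iso_trivial_sum (P R : Type) [AddCommGroup P] [Module.Free ℤ P] [Module.Finite ℤ P]
    [AddCommGroup R] [Module.Free ℤ R] [Module.Finite ℤ R] :
    Iso ((trivialFormation ε P).sum (trivialFormation ε R)) (trivialFormation ε (P × R)) := by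
  refine ⟨hypProd P R, ?_, ?_, ?_⟩
  · change Q.pullback (hypProd P R).toLinearMap (hyperbolic ε (P × R)) =
      Q.sum (hyperbolic ε P) (hyperbolic ε R)
    simp only [hyperbolic, Q.sum, Q.pullback_mk]
    rw [← map_add]
    congr 1
  · change ((hypL P).prod (hypL R)).map (hypProd P R).toLinearMap = hypL (P × R)
    ext ⟨⟨a, b⟩, f⟩
    constructor
    · rintro ⟨⟨⟨x, g⟩, ⟨y, h⟩⟩, ⟨⟨-, hg⟩, ⟨-, hh⟩⟩, he⟩
      obtain rfl : g = 0 := hg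
      obtain rfl : h = 0 := hh
      refine ⟨trivial, ?_⟩
      have := congrArg Prod.snd he
      rw [← this]
      change LinearMap.coprod 0 0 = 0
      ext <;> simp
    · rintro ⟨-, hf⟩
      obtain rfl : f = 0 := hf
      exact ⟨((a, 0), (b, 0)), ⟨⟨trivial, rfl⟩, ⟨trivial, rfl⟩⟩, by ext <;> simp [hypProd]⟩
  · change ((hypR P).prod (hypR R)).map (hypProd P R).toLinearMap = hypR (P × R)
    ext ⟨⟨a, b⟩, f⟩
    constructor
    · rintro ⟨⟨⟨x, g⟩, ⟨y, h⟩⟩, ⟨⟨hx, -⟩, ⟨hy, -⟩⟩, he⟩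
      obtain rfl : x = 0 := hx
      obtain rfl : y = 0 := hy
      exact ⟨(congrArg Prod.fst he).symm, trivial⟩
    · rintro ⟨h, -⟩
      cases h
      exact ⟨((0, f ∘ₗ LinearMap.inl ℤ P R), (0, f ∘ₗ LinearMap.inr ℤ P R)),
        ⟨⟨rfl, trivial⟩, ⟨rfl, trivial⟩⟩, by ext <;> simp [hypProd]⟩

theorem iso_zero_sum (x : QuasiFormation ε) : Iso ((trivialFormation ε PUnit).sum x) x := by
  have e : Unique (PUnit.{1} × Module.Dual ℤ PUnit.{1}) := by
    refine ⟨⟨0⟩, ?_⟩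
    rintro ⟨a, f⟩
    exact Prod.ext rfl (LinearMap.ext fun y => (map_zero f).trans (map_zero (0 : _ →ₗ[ℤ] ℤ)).symm)
  let f : ((PUnit.{1} × Module.Dual ℤ PUnit.{1}) × x.M) ≃ₗ[ℤ] x.M := LinearEquiv.uniqueProd
  have hmap : ∀ (S : Submodule ℤ (PUnit.{1} × Module.Dual ℤ PUnit.{1})) (S' : Submodule ℤ x.M),
      (S.prod S').map f.toLinearMap = S' := by
    intro S S'
    ext a
    constructor
    · rintro ⟨⟨z, y⟩, ⟨-, hy⟩, h⟩
      cases h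
      exact hy
    · intro ha
      exact ⟨(0, a), ⟨S.zero_mem, ha⟩, rfl⟩
  refine ⟨f, ?_, hmap _ _, hmap _ _⟩
  change Q.pullback f.toLinearMap x.ψ = Q.sum (hyperbolic ε PUnit.{1}) x.ψ
  have h0 : hyperbolic ε PUnit.{1} = 0 := by
    have h1 : hyperbolicPairing PUnit.{1} = 0 := by
      refine LinearMap.ext fun a => LinearMap.ext fun b => ?_
      rw [Subsingleton.elim a 0, map_zero]
      simp
    rw [hyperbolic, h1, map_zero]
  rw [h0]
  simp only [Q.sum, map_zero, zero_add]
  rfl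

instance isoSetoid (ε : ℤˣ) : Setoid (QuasiFormation ε) where
  r := Iso
  iseqv := ⟨Iso.refl, Iso.symm, Iso.trans⟩

/-- Isomorphism classes of quasi-formations. -/
def IsoClass (ε : ℤˣ) : Type 1 := Quotient (isoSetoid ε)

/-- The isomorphism class of a quasi-formation. -/
def isoClass (x : QuasiFormation ε) : IsoClass ε := Quotient.mk _ x

instance : Add (IsoClass ε) :=
  ⟨Quotient.map₂ QuasiFormation.sum fun _ _ h _ _ h' => Iso.sum h h'⟩

instance : Zero (IsoClass ε) := ⟨isoClass (trivialFormation ε PUnit)⟩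

/-- The monoid of isomorphism classes under direct sum. -/
instance : AddCommMonoid (IsoClass ε) where
  add_assoc := by
    rintro ⟨a⟩ ⟨b⟩ ⟨c⟩
    exact Quotient.sound (iso_sum_assoc a b c)
  zero_add := by
    rintro ⟨a⟩
    exact Quotient.sound (iso_zero_sum a)
  add_zero := by
    rintro ⟨a⟩
    exact Quotient.sound ((iso_sum_comm _ _).trans (iso_zero_sum a))
  add_comm := by
    rintro ⟨a⟩ ⟨b⟩
    exact Quotient.sound (iso_sum_comm a b)
  nsmul := nsmulRec

theorem isoClass_trivial_prod (P R : Type) [AddCommGroup P] [Module.Free ℤ P] [Module.Finite ℤ P]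
    [AddCommGroup R] [Module.Free ℤ R] [Module.Finite ℤ R] :
    isoClass (trivialFormation ε P) + isoClass (trivialFormation ε R) =
      isoClass (trivialFormation ε (P × R)) :=
  Quotient.sound (iso_trivial_sum P R)

/-- Stable isomorphism: isomorphism after the addition of trivial formations. -/
def stableIso (ε : ℤˣ) : AddCon (IsoClass ε) where
  r a b := ∃ (P P' : Type) (_ : AddCommGroup P) (_ : Module.Free ℤ P) (_ : Module.Finite ℤ P)
    (_ : AddCommGroup P') (_ : Module.Free ℤ P') (_ : Module.Finite ℤ P'),
    a + isoClass (trivialFormation ε P) = b + isoClass (trivialFormation ε P')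
  iseqv := by
    refine ⟨fun a => ⟨PUnit, PUnit, inferInstance, inferInstance, inferInstance, inferInstance,
      inferInstance, inferInstance, rfl⟩, ?_, ?_⟩
    · rintro a b ⟨P, P', _, _, _, _, _, _, h⟩
      exact ⟨P', P, inferInstance, inferInstance, inferInstance, inferInstance,
        inferInstance, inferInstance, h.symm⟩
    · rintro a b c ⟨P, P', _, _, _, _, _, _, h⟩ ⟨R, R', _, _, _, _, _, _, h'⟩
      refine ⟨P × R, P' × R', inferInstance, inferInstance, inferInstance, inferInstance,
        inferInstance, inferInstance, ?_⟩
      rw [← isoClass_trivial_prod, ← isoClass_trivial_prod, ← add_assoc, h, add_right_comm, h']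
      abel
  add' := by
    rintro a b c d ⟨P, P', _, _, _, _, _, _, h⟩ ⟨R, R', _, _, _, _, _, _, h'⟩
    refine ⟨P × R, P' × R', inferInstance, inferInstance, inferInstance, inferInstance,
      inferInstance, inferInstance, ?_⟩
    rw [← isoClass_trivial_prod, ← isoClass_trivial_prod, add_add_add_comm, h, h',
      add_add_add_comm]

/-- The unital abelian monoid of stable isomorphism classes of quasi-formations. -/
abbrev StableClass (ε : ℤˣ) : Type 1 := (stableIso ε).Quotient

/-- The stable isomorphism class of a quasi-formation. -/
def stableClass (x : QuasiFormation ε) : StableClass ε := ((x.isoClass : IsoClass ε) : StableClass ε)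

/-- The relation `(M, ψ; K, L) ⊕ (M, ψ; L, V) ∼ (M, ψ; K, V)`, where `K` and `L` are
Lagrangians. -/
inductive Shift (ε : ℤˣ) : StableClass ε → StableClass ε → Prop
  | shift (x : QuasiFormation ε) (K : Submodule ℤ x.M) (hK : IsLagrangian x.ψ K) :
      Shift ε (stableClass (x.formation K hK) + stableClass x) (stableClass (x.replaceL K hK))

end QuasiFormation

/-- The monoid `l_{2q+1}(ℤ)`, `ε = (-1)^q`: stable isomorphism classes of `ε`-quadratic
quasi-formations modulo the congruence generated by the shift relation.  In particular
`l_3(ℤ) = LMonoid (-1)`. -/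
abbrev LMonoid (ε : ℤˣ) : Type 1 := (addConGen (QuasiFormation.Shift ε)).Quotient

/-- The class `[x] = [M, ψ; L, V]` of a quasi-formation. -/
def QuasiFormation.toL {ε : ℤˣ} (x : QuasiFormation ε) : LMonoid ε :=
  ((x.stableClass : QuasiFormation.StableClass ε) : LMonoid ε)

/-- An element of `l_{2q+1}(ℤ)` is elementary if it is represented by the boundary of an
asymmetric form. -/
def IsElementary {ε : ℤˣ} (a : LMonoid ε) : Prop :=
  ∃ (K : Type) (_ : AddCommGroup K) (_ : Module.Free ℤ K) (_ : Module.Finite ℤ K)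
    (ρ : BilinForm ℤ K), (QuasiFormation.boundary ε K ρ).toL = a

/-! ### The map `b` -/

section Boundary

variable {ε : ℤˣ}

/-- The form induced on a submodule. -/
def restrict {M : Type} [AddCommGroup M] [Module.Free ℤ M] [Module.Finite ℤ M] (ψ : Q ε M)
    (S : Submodule ℤ M) : Form ε where
  carrier := S
  θ := Q.pullback S.subtype ψ

theorem restrict_isometric {M N : Type} [AddCommGroup M] [Module.Free ℤ M] [Module.Finite ℤ M]
    [AddCommGroup N] [Module.Free ℤ N] [Module.Finite ℤ N] (ψ : Q ε N) (f : M ≃ₗ[ℤ] N)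
    (S : Submodule ℤ M) :
    Form.Isometric (restrict (Q.pullback f.toLinearMap ψ) S)
      (restrict ψ (S.map f.toLinearMap)) := by
  refine ⟨f.submoduleMap S, ?_⟩
  change Q.pullback (f.submoduleMap S).toLinearMap
    (Q.pullback (S.map f.toLinearMap).subtype ψ) = Q.pullback S.subtype (Q.pullback f.toLinearMap ψ)
  rw [Q.pullback_pullback, Q.pullback_pullback]
  rfl

theorem restrict_prod {M N : Type} [AddCommGroup M] [Module.Free ℤ M] [Module.Finite ℤ M]
    [AddCommGroup N] [Module.Free ℤ N] [Module.Finite ℤ N] (ψ : Q ε M) (ψ' : Q ε N)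
    (S : Submodule ℤ M) (S' : Submodule ℤ N) :
    Form.Isometric (restrict (Q.sum ψ ψ') (S.prod S')) ((restrict ψ S).sum (restrict ψ' S')) :=
  ⟨prodSub S S', pullback_prodSub ψ ψ' S S'⟩

namespace QuasiFormation

/-- The form `(V, θ)` induced on `V`. -/
def formV (x : QuasiFormation ε) : Form ε := restrict x.ψ x.V

/-- The form `(V^⊥, -θ^⊥)`: the negative of the form induced on the annihilator of `V`. -/
def formVPerp (x : QuasiFormation ε) : Form ε := restrict (-x.ψ) (annihilator x.ψ x.V)

theorem formV_iso {x y : QuasiFormation ε} : Iso x y → Form.Isometric x.formV y.formV := by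
  rintro ⟨f, hf, -, hV⟩
  have := restrict_isometric y.ψ f x.V
  rwa [hf, hV] at this

theorem formVPerp_iso {x y : QuasiFormation ε} :
    Iso x y → Form.Isometric x.formVPerp y.formVPerp := by
  rintro ⟨f, hf, -, hV⟩
  have := restrict_isometric (-y.ψ) f (annihilator x.ψ x.V)
  rw [map_neg, hf] at this
  have h2 := annihilator_map y.ψ f x.V
  rw [hf, hV] at h2
  rwa [← h2] at this

theorem formV_sum (x y : QuasiFormation ε) :
    (x.sum y).formV.toFZS = x.formV.toFZS + y.formV.toFZS :=
  Form.toFZS_congr (restrict_prod x.ψ y.ψ x.V y.V)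

theorem formVPerp_sum (x y : QuasiFormation ε) :
    (x.sum y).formVPerp.toFZS = x.formVPerp.toFZS + y.formVPerp.toFZS := by
  rw [← Form.toFZS_sum]
  refine Form.toFZS_congr ?_
  have h := restrict_prod (-x.ψ) (-y.ψ) (annihilator x.ψ x.V) (annihilator y.ψ y.V)
  rw [← annihilator_prod] at h
  have h2 : Q.sum (-x.ψ) (-y.ψ) = -Q.sum x.ψ y.ψ := by
    simp only [Q.sum, map_neg, neg_add]
  rw [h2] at h
  exact h

theorem formV_lagrangian (x : QuasiFormation ε) (h : IsLagrangian x.ψ x.V) :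
    x.formV.toFZS = 0 :=
  Form.toFZS_zero _ h.pullback_eq

theorem formVPerp_lagrangian (x : QuasiFormation ε) (h : IsLagrangian x.ψ x.V) :
    x.formVPerp.toFZS = 0 := by
  rw [formVPerp, h.annihilator_eq]
  refine Form.toFZS_zero _ ?_
  have := congrArg Neg.neg h.pullback_eq
  rw [← map_neg, neg_zero] at this
  exact this

/-- The map `x ↦ ([V, θ], [V^⊥, -θ^⊥])` on isomorphism classes. -/
def bIso (ε : ℤˣ) : IsoClass ε →+ FZS ε × FZS ε where
  toFun := Quotient.lift (fun x => (x.formV.toFZS, x.formVPerp.toFZS)) fun _ _ h =>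
    Prod.ext (Form.toFZS_congr (formV_iso h)) (Form.toFZS_congr (formVPerp_iso h))
  map_zero' := Prod.ext (formV_lagrangian _ hypR_lagrangian)
    (formVPerp_lagrangian _ hypR_lagrangian)
  map_add' := by
    rintro ⟨x⟩ ⟨y⟩
    exact Prod.ext (formV_sum x y) (formVPerp_sum x y)

theorem bIso_isoClass (x : QuasiFormation ε) :
    bIso ε x.isoClass = (x.formV.toFZS, x.formVPerp.toFZS) := rfl

theorem bIso_lagrangian (x : QuasiFormation ε) (h : IsLagrangian x.ψ x.V) :
    bIso ε x.isoClass = 0 :=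
  Prod.ext (formV_lagrangian x h) (formVPerp_lagrangian x h)

/-- The map `b` on stable isomorphism classes. -/
def bStable (ε : ℤˣ) : StableClass ε →+ FZS ε × FZS ε :=
  (stableIso ε).lift (bIso ε) (by
    rintro a b ⟨P, P', _, _, _, _, _, _, h⟩
    have := congrArg (bIso ε) h
    rw [map_add, map_add, bIso_lagrangian (trivialFormation ε P) hypR_lagrangian,
      bIso_lagrangian (trivialFormation ε P') hypR_lagrangian, add_zero, add_zero] at this
    exact this)

end QuasiFormation

/-- The monoid map `b : l_{2q+1}(ℤ) → F^{zs}_{2q}(ℤ) × F^{zs}_{2q}(ℤ)`,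
`[M, ψ; L, V] ↦ ([V, θ], [V^⊥, -θ^⊥])`. -/
def b (ε : ℤˣ) : LMonoid ε →+ FZS ε × FZS ε :=
  (addConGen (QuasiFormation.Shift ε)).lift (QuasiFormation.bStable ε) (by
    rw [AddCon.addConGen_le]
    rintro _ _ ⟨x, K, hK⟩
    rw [AddCon.ker_rel, map_add]
    change QuasiFormation.bIso ε (x.formation K hK).isoClass + QuasiFormation.bIso ε x.isoClass =
      QuasiFormation.bIso ε (x.replaceL K hK).isoClass
    rw [QuasiFormation.bIso_lagrangian (x.formation K hK) x.lagrangian, zero_add]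
    rfl)

theorem b_toL (x : QuasiFormation ε) : b ε x.toL = (x.formV.toFZS, x.formVPerp.toFZS) := rfl

end Boundary

end

end Surgery

namespace Surgery

noncomputable section

/-! ### The quadratic refinement of a skew-quadratic form -/

section Quad

variable {M : Type} [AddCommGroup M]

/-! On a finitely generated free module, a class in Q_{-1}(M) amounts to an alternating form
together with a quadratic refinement M → ℤ/2 (`Q.ext_symm_quad`), so isometries and Lagrangians are
checked on these two.

Two facts carry the proof. First, in a nonsingular form with a Lagrangian modulo 2, every half rank
summand V has a Lagrangian complement (`exists_isLagrangian_isCompl`). By induction on the rank: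
some e with refinement 0 pairs to 1 with a vector of V and with a vector of V^⊥; split off a
hyperbolic plane with first basis vector e and project V ∩ e^⊥ to the rest. The vector e comes from
a local-to-global argument (`exists_dual_on_both`), in which the Lagrangian modulo 2 removes the
Arf-type obstruction at the prime 2.

Second, any two Lagrangians form a formation of trivial class (`isNull_of_isLagrangian`), which is
the vanishing of L_3(ℤ). Complementary Lagrangians give a trivial formation, and the shift relation
makes nullity transitive. In rank two the chain of complementary Lagrangians is a Euclidean
algorithm with even quotients; in higher rank an intermediate Lagrangian shares a primitive vector
with each end, which lowers the rank.

By the second fact and the shift relation the class of (M, ψ; L, V) does not depend on L. By the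
first, choose a Lagrangian J complementary to V and a Lagrangian K complementary to J: then M =
H(K), J = K^*, and V is a graph of some ρ, so the class is elementary. Here V^⊥ is the graph of the
transpose ρ^t, and -ρ^t = Tρ has the class of ρ, so both components of b agree. If ρ and ρ' give
isometric forms, then after transport they differ by some σ + σ^t, and the shear by this difference
is an isometry of the hyperbolic form carrying one graph to the other; it moves the Lagrangian,
which is harmless. A trivial summand adds a zero form to V. Hence the first component of b is
injective, and boundaries make it surjective. -/

theorem ZMod.two_mul_self (c : ZMod 2) : c * c = c := by
  revert c; decide

theorem ZMod.two_add_self (c : ZMod 2) : c + c = 0 := by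
  revert c; decide

/-- The quadratic refinement `x ↦ ρ(x)(x)` modulo `2` of the class of `ρ` in `Q_{-1}(M)`. -/
def Q.quadHom (x : M) : Q (-1) M →ₗ[ℤ] ZMod 2 :=
  Submodule.liftQ (LinearMap.range (LinearMap.id - duality (-1) M))
    { toFun := fun ρ => ((ρ x x : ℤ) : ZMod 2)
      map_add' := fun ρ ρ' => by simp
      map_smul' := fun c ρ => by simp } (by
      rintro _ ⟨φ, rfl⟩
      simp [duality, ZMod.two_add_self])

/-- The quadratic refinement `M → ℤ/2` of a skew-quadratic form. -/
def Q.quad (ψ : Q (-1) M) (x : M) : ZMod 2 := Q.quadHom x ψ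

@[simp] theorem Q.quad_mk (ρ : BilinForm ℤ M) (x : M) :
    Q.quad (Q.mk (-1) ρ) x = ((ρ x x : ℤ) : ZMod 2) := rfl

@[simp] theorem Q.quad_zero_form (x : M) : Q.quad (0 : Q (-1) M) x = 0 :=
  map_zero (Q.quadHom x)

theorem Q.quad_add_form (ψ ψ' : Q (-1) M) (x : M) :
    Q.quad (ψ + ψ') x = Q.quad ψ x + Q.quad ψ' x :=
  map_add (Q.quadHom x) ψ ψ'

theorem Q.symm_neg_swap (ψ : Q (-1) M) (x y : M) : Q.symm ψ x y = -Q.symm ψ y x := by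
  rw [Q.symm_swap]; simp

@[simp] theorem Q.symm_self (ψ : Q (-1) M) (x : M) : Q.symm ψ x x = 0 := by
  have := Q.symm_neg_swap ψ x x
  omega

@[simp] theorem Q.quad_zero (ψ : Q (-1) M) : Q.quad ψ 0 = 0 := by
  obtain ⟨ρ, rfl⟩ := Q.mk_surjective ψ
  simp

theorem Q.quad_add (ψ : Q (-1) M) (x y : M) :
    Q.quad ψ (x + y) = Q.quad ψ x + Q.quad ψ y + ((Q.symm ψ x y : ℤ) : ZMod 2) := by
  obtain ⟨ρ, rfl⟩ := Q.mk_surjective ψ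
  simp only [Q.quad_mk, Q.symm_mk, map_add, LinearMap.add_apply]
  push_cast
  have h := ZMod.two_add_self ((ρ y x : ℤ) : ZMod 2)
  have h2 : (-1 : ZMod 2) = 1 := by decide
  simp only [h2]
  ring

theorem Q.quad_smul (ψ : Q (-1) M) (c : ℤ) (x : M) :
    Q.quad ψ (c • x) = (c : ZMod 2) * Q.quad ψ x := by
  obtain ⟨ρ, rfl⟩ := Q.mk_surjective ψ
  simp only [Q.quad_mk, map_smul, LinearMap.smul_apply, smul_eq_mul]
  push_cast
  rw [← mul_assoc, ZMod.two_mul_self]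

/-- The refinement factors through M/2M, so a vector can be corrected by doubles to adjust its
integral pairings without changing its refinement. -/
theorem Q.quad_add_two_smul (ψ : Q (-1) M) (x y : M) :
    Q.quad ψ (x + (2 : ℤ) • y) = Q.quad ψ x := by
  rw [Q.quad_add, Q.quad_smul, map_smul, smul_eq_mul]
  push_cast
  have h' : (2 : ZMod 2) = 0 := by decide
  simp [h']

@[simp] theorem Q.quad_pullback {N : Type} [AddCommGroup N] (f : N →ₗ[ℤ] M) (ψ : Q (-1) M)
    (x : N) : Q.quad (Q.pullback f ψ) x = Q.quad ψ (f x) := by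
  obtain ⟨ρ, rfl⟩ := Q.mk_surjective ψ
  simp [Q.pullback_mk]

@[simp] theorem Q.quad_sum {N : Type} [AddCommGroup N] (ψ : Q (-1) M) (ψ' : Q (-1) N)
    (x : M × N) : Q.quad (Q.sum ψ ψ') x = Q.quad ψ x.1 + Q.quad ψ' x.2 := by
  simp [Q.sum, Q.quad_add_form]

/-- A representative ρ is symmetric with even diagonal. With σ its strictly upper triangular part
plus half the diagonal, ρ = σ + σ^t = (1 - T)σ. -/
theorem Q.eq_zero_of_symm_quad [Module.Free ℤ M] [Module.Finite ℤ M] (ψ : Q (-1) M)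
    (hs : ∀ x y, Q.symm ψ x y = 0) (hq : ∀ x, Q.quad ψ x = 0) : ψ = 0 := by
  obtain ⟨ρ, rfl⟩ := Q.mk_surjective ψ
  let b := Module.finBasis ℤ M
  have hsym : ∀ x y, ρ x y = ρ y x := fun x y => by
    have := hs x y
    simp at this
    omega
  have hev : ∀ x, ∃ k, ρ x x = 2 * k := fun x => by
    have := hq x
    rw [Q.quad_mk, ZMod.intCast_zmod_eq_zero_iff_dvd] at this
    exact this
  obtain ⟨σ, hσ⟩ : ∃ σ : BilinForm ℤ M, ∀ i j, σ (b i) (b j) =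
      if i < j then ρ (b i) (b j) else if i = j then ρ (b i) (b i) / 2 else 0 :=
    ⟨Matrix.toBilin b (Matrix.of fun i j =>
      if i < j then ρ (b i) (b j) else if i = j then ρ (b i) (b i) / 2 else 0), fun i j => by
        rw [← LinearMap.BilinForm.toMatrix_apply b, LinearMap.BilinForm.toMatrix_toBilin,
          Matrix.of_apply]⟩
  refine (Submodule.Quotient.mk_eq_zero _).2 ⟨σ, ?_⟩
  refine LinearMap.BilinForm.ext_basis b fun i j => ?_
  have h0 : (σ - duality (-1) M σ) (b i) (b j) = σ (b i) (b j) + σ (b j) (b i) := by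
    simp [duality]
  refine h0.trans ?_
  rw [ hσ, hσ]
  rcases lt_trichotomy i j with h | rfl | h
  · simp [h, h.not_gt, h.ne']
  · obtain ⟨k, hk⟩ := hev (b i)
    simp
    omega
  · simp [h, h.not_gt, h.ne', hsym (b i)]

theorem Q.ext_symm_quad [Module.Free ℤ M] [Module.Finite ℤ M] {ψ ψ' : Q (-1) M}
    (hs : ∀ x y, Q.symm ψ x y = Q.symm ψ' x y) (hq : ∀ x, Q.quad ψ x = Q.quad ψ' x) :
    ψ = ψ' := by
  rw [← sub_eq_zero]
  refine Q.eq_zero_of_symm_quad _ (fun x y => ?_) fun x => ?_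
  · rw [map_sub, LinearMap.sub_apply, LinearMap.sub_apply, hs, sub_self]
  · change Q.quadHom x (ψ - ψ') = 0
    rw [map_sub]
    exact sub_eq_zero.2 (hq x)

theorem Q.pullback_eq_of_symm_quad {N : Type} [AddCommGroup N] [Module.Free ℤ N]
    [Module.Finite ℤ N] (f : N →ₗ[ℤ] M) (ψ : Q (-1) M) (ψ' : Q (-1) N)
    (hs : ∀ x y, Q.symm ψ (f x) (f y) = Q.symm ψ' x y) (hq : ∀ x, Q.quad ψ (f x) = Q.quad ψ' x) :
    Q.pullback f ψ = ψ' :=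
  Q.ext_symm_quad (fun x y => by rw [Q.symm_pullback, hs]) fun x => by rw [Q.quad_pullback, hq]

end Quad

/-! ### Primitive vectors and summands -/

section Primitive

variable {M : Type} [AddCommGroup M] [Module.Free ℤ M] [Module.Finite ℤ M]

/-- A vector on which some functional takes the value `1`. -/
def Primitive {M : Type} [AddCommGroup M] (x : M) : Prop := ∃ g : Module.Dual ℤ M, g x = 1

/-- Take for c a generator of the ideal of values of functionals at x. It divides all coordinates,
and a functional with value c at x has value 1 at x/c. -/
theorem exists_eq_smul_primitive {x : M} (hx : x ≠ 0) :
    ∃ (c : ℤ) (y : M), c ≠ 0 ∧ x = c • y ∧ Primitive y := by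
  let I : Ideal ℤ := LinearMap.range (Module.Dual.eval ℤ M x)
  obtain ⟨c, hc⟩ := (IsPrincipalIdealRing.principal I).principal
  have hdvd : ∀ g : Module.Dual ℤ M, c ∣ g x := fun g => by
    have : g x ∈ I := ⟨g, rfl⟩
    rw [hc] at this
    exact Ideal.mem_span_singleton.1 this
  have hc0 : c ≠ 0 := by
    rintro rfl
    exact hx ((Module.forall_dual_apply_eq_zero_iff ℤ x).1 fun g => by simpa using hdvd g)
  let b := Module.finBasis ℤ M
  choose k hk using fun i => hdvd (b.coord i)
  have hxy : x = c • ∑ i, k i • b i := by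
    refine b.ext_elem fun i => ?_
    have := hk i
    simp only [Module.Basis.coord_apply] at this
    rw [this]
    simp [Finsupp.single_apply]
  refine ⟨c, _, hc0, hxy, ?_⟩
  obtain ⟨g, hg⟩ : c ∈ I := hc ▸ Ideal.mem_span_singleton_self c
  refine ⟨g, ?_⟩
  change g x = c at hg
  rw [hxy, map_smul, smul_eq_mul] at hg
  exact (mul_eq_left₀ hc0).1 hg

/-- Saturation means that the quotient is torsion free, hence free, so the projection splits. -/
theorem isSummand_iff_saturated {V : Submodule ℤ M} :
    IsSummand V ↔ ∀ (c : ℤ) (x : M), c ≠ 0 → c • x ∈ V → x ∈ V := by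
  constructor
  · rintro ⟨C, hC⟩ c x hc hx
    have h1 : V.projection C hC (c • x) = c • x :=
      V.projection_apply_left hC ⟨c • x, hx⟩
    rw [map_smul] at h1
    have h2 := smul_right_injective M hc h1
    rw [← h2]
    simp
  · intro h
    have : Module.IsTorsionFree ℤ (M ⧸ V) := by
      refine Module.IsTorsionFree.of_smul_eq_zero fun c x hx => ?_
      obtain ⟨x, rfl⟩ := V.mkQ_surjective x
      by_cases hc : c = 0
      · exact Or.inl hc
      · right
        rw [← map_smul] at hx
        exact (Submodule.Quotient.mk_eq_zero V).2 (h c x hc ((Submodule.Quotient.mk_eq_zero V).1 hx))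
    obtain ⟨s, hs⟩ := Module.projective_lifting_property V.mkQ LinearMap.id V.mkQ_surjective
    have hs' : ∀ x, V.mkQ (s x) = x := fun x => LinearMap.congr_fun hs x
    refine ⟨LinearMap.range s, ?_, ?_⟩
    · rw [Submodule.disjoint_def]
      rintro _ hx ⟨y, rfl⟩
      have := (Submodule.Quotient.mk_eq_zero V).2 hx
      have h2 := hs' y
      rw [Submodule.mkQ_apply, this] at h2
      rw [← h2, map_zero]
    · rw [codisjoint_iff, eq_top_iff]
      intro x _
      refine Submodule.mem_sup.2 ⟨x - s (V.mkQ x), ?_, s (V.mkQ x), ⟨_, rfl⟩, by simp⟩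
      rw [← Submodule.Quotient.mk_eq_zero V]
      change V.mkQ (x - s (V.mkQ x)) = 0
      rw [map_sub, hs', sub_self]

theorem exists_extension {M : Type} [AddCommGroup M] {V : Submodule ℤ M} (hV : IsSummand V) (g : Module.Dual ℤ V) :
    ∃ g' : Module.Dual ℤ M, ∀ v : V, g' v = g v := by
  obtain ⟨C, hC⟩ := hV
  exact ⟨g ∘ₗ V.projectionOnto C hC, fun v => by simp⟩

theorem exists_primitive_mem {V : Submodule ℤ M} (hV : IsSummand V) {x : M} (hx : x ∈ V)
    (hx0 : x ≠ 0) : ∃ (c : ℤ) (y : M), c ≠ 0 ∧ x = c • y ∧ Primitive y ∧ y ∈ V := by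
  obtain ⟨c, y, hc, rfl, hy⟩ := exists_eq_smul_primitive hx0
  exact ⟨c, y, hc, rfl, hy, isSummand_iff_saturated.1 hV c y hc hx⟩

end Primitive

/-! ### Annihilators in nonsingular forms -/

section Annihilator

variable {M : Type} [AddCommGroup M] {ψ : Q (-1) M}

/-- Nonsingularity of a skew-quadratic form. -/
abbrev Nonsingular (ψ : Q (-1) M) : Prop :=
  Function.Bijective (Q.symm ψ : M →ₗ[ℤ] Module.Dual ℤ M)

theorem mem_annihilator {S : Submodule ℤ M} {x : M} :
    x ∈ annihilator ψ S ↔ ∀ y ∈ S, Q.symm ψ x y = 0 := Iff.rfl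

theorem Nonsingular.exists_symm_eq (h : Nonsingular ψ) (g : Module.Dual ℤ M) :
    ∃ x, ∀ y, Q.symm ψ x y = g y := by
  obtain ⟨x, hx⟩ := h.2 g
  exact ⟨x, fun y => by rw [hx]⟩

theorem Nonsingular.eq_zero (h : Nonsingular ψ) {x : M} (hx : ∀ y, Q.symm ψ x y = 0) : x = 0 :=
  h.1 (by rw [map_zero]; exact LinearMap.ext hx)

theorem Nonsingular.exists_symm_eq_on (h : Nonsingular ψ) {V : Submodule ℤ M} (hV : IsSummand V)
    (g : Module.Dual ℤ V) : ∃ x, ∀ v : V, Q.symm ψ x v = g v := by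
  obtain ⟨g', hg'⟩ := exists_extension hV g
  obtain ⟨x, hx⟩ := h.exists_symm_eq g'
  exact ⟨x, fun v => by rw [hx, hg']⟩

theorem Nonsingular.exists_dual_vector (h : Nonsingular ψ) {x : M} (hx : Primitive x) :
    ∃ y, Q.symm ψ y x = 1 := by
  obtain ⟨g, hg⟩ := hx
  obtain ⟨y, hy⟩ := h.exists_symm_eq g
  exact ⟨y, by rw [hy, hg]⟩

theorem primitive_of_symm_eq_one {x y : M} (h : Q.symm ψ y x = 1) : Primitive x :=
  ⟨Q.symm ψ y, h⟩

/-- A vector pairing evenly with a summand `V` is congruent modulo `2` to one of `V^⊥`. -/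
theorem Nonsingular.exists_sub_two_smul_mem_annihilator (h : Nonsingular ψ) {V : Submodule ℤ M}
    (hV : IsSummand V) {x : M} (hx : ∀ v ∈ V, Even (Q.symm ψ x v)) :
    ∃ y, x - (2 : ℤ) • y ∈ annihilator ψ V := by
  have hx' : ∀ v : V, 2 * (Q.symm ψ x v / 2) = Q.symm ψ x v := fun v =>
    Int.mul_ediv_cancel' (hx v v.2).two_dvd
  -- Half of the pairing with x is an integral functional on V; y represents it.
  let g : Module.Dual ℤ V :=
    { toFun := fun v => Q.symm ψ x v / 2
      map_add' := fun v w => by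
        have h1 := hx' v
        have h2 := hx' w
        have h3 := hx' (v + w)
        simp only [Submodule.coe_add, map_add] at h3 ⊢
        omega
      map_smul' := fun c v => by
        have h1 := hx' v
        have h3 := hx' (c • v)
        refine mul_left_cancel₀ (two_ne_zero (α := ℤ)) ?_
        rw [h3, Submodule.coe_smul, map_smul, smul_eq_mul, smul_eq_mul, RingHom.id_apply,
          mul_left_comm, h1] }
  obtain ⟨y, hy⟩ := h.exists_symm_eq_on hV g
  refine ⟨y, fun v hv => ?_⟩
  have h1 := hy ⟨v, hv⟩
  have h2 := hx' ⟨v, hv⟩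
  simp only [g, LinearMap.coe_mk, AddHom.coe_mk] at h1 h2
  rw [map_sub, map_smul, LinearMap.sub_apply, LinearMap.smul_apply, h1, smul_eq_mul, h2, sub_self]

theorem le_annihilator_annihilator (ψ : Q (-1) M) (V : Submodule ℤ M) :
    V ≤ annihilator ψ (annihilator ψ V) := fun v hv w hw => by
  rw [Q.symm_neg_swap, hw v hv, neg_zero]

theorem isSummand_annihilator [Module.Free ℤ M] [Module.Finite ℤ M] (ψ : Q (-1) M) (V : Submodule ℤ M) :
    IsSummand (annihilator ψ V) :=
  isSummand_iff_saturated.2 fun c x hc hx y hy => by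
    have := hx y hy
    rw [map_smul, LinearMap.smul_apply, smul_eq_mul] at this
    exact (mul_eq_zero.1 this).resolve_left hc

/-- Let C be a complement of V. A functional factoring through the projection to C along V is
represented by a vector of V^⊥, so it vanishes on V^⊥⊥; hence V^⊥⊥ has zero component in C. -/
theorem Nonsingular.annihilator_annihilator [Module.Free ℤ M] (h : Nonsingular ψ) {V : Submodule ℤ M}
    (hV : IsSummand V) : annihilator ψ (annihilator ψ V) = V := by
  refine le_antisymm (fun x hx => ?_) (le_annihilator_annihilator ψ V)
  obtain ⟨C, hC⟩ := hV
  refine (Submodule.projection_apply_eq_zero_iff hC.symm).1 ?_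
  · refine (Module.forall_dual_apply_eq_zero_iff ℤ _).1 fun g => ?_
    obtain ⟨y, hy⟩ := h.exists_symm_eq (g ∘ₗ C.projection V hC.symm)
    have hyV : y ∈ annihilator ψ V := fun v hv => by
      rw [hy, LinearMap.comp_apply, Submodule.projection_apply_of_mem_right hC.symm hv, map_zero]
    have h1 := hx y hyV
    rw [Q.symm_neg_swap, hy, neg_eq_zero] at h1
    exact h1

/-- Lagrangians are detected by the symmetrisation and the quadratic refinement. -/
theorem isLagrangian_of [Module.Free ℤ M] [Module.Finite ℤ M] {L : Submodule ℤ M} (hL : annihilator ψ L = L)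
    (hq : ∀ x ∈ L, Q.quad ψ x = 0) : IsLagrangian ψ L where
  summand := hL ▸ isSummand_annihilator ψ L
  annihilator_eq := hL
  pullback_eq := by
    have hL' : ∀ x ∈ L, x ∈ annihilator ψ L := fun x hx => hL.symm ▸ hx
    refine Q.pullback_eq_of_symm_quad _ _ _ (fun x y => ?_) fun x => ?_
    · rw [map_zero]
      exact hL' x x.2 y y.2
    · rw [Q.quad_zero_form]
      exact hq x x.2

end Annihilator

/-! ### Elementary properties of Lagrangians -/

section Lagrangian

variable {M : Type} [AddCommGroup M] {ψ : Q (-1) M} {L : Submodule ℤ M}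

theorem IsLagrangian.symm_eq_zero (h : IsLagrangian ψ L) {x y : M} (hx : x ∈ L) (hy : y ∈ L) :
    Q.symm ψ x y = 0 := by
  rw [← h.annihilator_eq] at hx
  exact hx y hy

theorem IsLagrangian.mem (h : IsLagrangian ψ L) {x : M} (hx : ∀ y ∈ L, Q.symm ψ x y = 0) :
    x ∈ L := by
  rw [← h.annihilator_eq]
  exact hx

theorem IsLagrangian.quad_eq_zero (h : IsLagrangian ψ L) {x : M} (hx : x ∈ L) :
    Q.quad ψ x = 0 := by
  have := Q.quad_pullback L.subtype ψ ⟨x, hx⟩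
  rw [h.pullback_eq, Q.quad_zero_form] at this
  exact this.symm

theorem IsLagrangian.map {N : Type} [AddCommGroup N] [Module.Free ℤ N] [Module.Finite ℤ N]
    {ψ : Q (-1) N} (f : M ≃ₗ[ℤ] N) (h : IsLagrangian (Q.pullback f.toLinearMap ψ) L) :
    IsLagrangian ψ (L.map f.toLinearMap) := by
  refine isLagrangian_of ?_ ?_
  · rw [annihilator_map, h.annihilator_eq]
  · rintro _ ⟨x, hx, rfl⟩
    rw [← Q.quad_pullback]
    exact h.quad_eq_zero hx

end Lagrangian

/-! ### Splitting off a hyperbolic plane -/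

section Plane

/-- The hyperbolic plane `((a, b), (c, d)) ↦ a d` on `ℤ ⊕ ℤ`. -/
def plane : Q (-1) (ℤ × ℤ) :=
  Q.mk (-1) (LinearMap.mk₂ ℤ (fun x y => x.1 * y.2) (fun _ _ _ => by simp [add_mul])
    (fun _ _ _ => by simp [mul_assoc]) (fun _ _ _ => by simp [mul_add])
    (fun _ _ _ => by simp [mul_left_comm]))

@[simp] theorem symm_plane (x y : ℤ × ℤ) : Q.symm plane x y = x.1 * y.2 - x.2 * y.1 := by
  simp [plane]
  ring

@[simp] theorem quad_plane (x : ℤ × ℤ) : Q.quad plane x = ((x.1 * x.2 : ℤ) : ZMod 2) := rfl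

theorem plane_nonsingular : Nonsingular plane := by
  constructor
  · rw [injective_iff_map_eq_zero]
    intro x hx
    have h1 := LinearMap.congr_fun hx (0, 1)
    have h2 := LinearMap.congr_fun hx (1, 0)
    simp at h1 h2
    exact Prod.ext h1 h2
  · intro g
    refine ⟨(g (0, 1), -g (1, 0)), ?_⟩
    ext <;> simp

/-- The Lagrangian `ℤ ⊕ 0` of the hyperbolic plane. -/
def planeL : Submodule ℤ (ℤ × ℤ) := (⊤ : Submodule ℤ ℤ).prod ⊥

theorem mem_planeL {x : ℤ × ℤ} : x ∈ planeL ↔ x.2 = 0 := by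
  simp [planeL, Submodule.mem_prod]

theorem planeL_lagrangian : IsLagrangian plane planeL := by
  refine isLagrangian_of ?_ fun x hx => ?_
  · ext x
    rw [mem_annihilator, mem_planeL]
    constructor
    · intro h
      simpa using h (1, 0) (mem_planeL.2 rfl)
    · intro h y hy
      rw [mem_planeL] at hy
      simp [h, hy]
  · rw [mem_planeL] at hx
    simp [hx]

variable {M N : Type} [AddCommGroup M] [AddCommGroup N]

theorem Nonsingular.of_sum {ψ : Q (-1) M} {ψ' : Q (-1) N} (h : Nonsingular (Q.sum ψ ψ')) :
    Nonsingular ψ' := by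
  constructor
  · rw [injective_iff_map_eq_zero]
    intro x hx
    have : ((0, x) : M × N) = 0 := h.eq_zero fun y => by simp [hx]
    exact congrArg Prod.snd this
  · intro g
    obtain ⟨x, hx⟩ := h.exists_symm_eq (g ∘ₗ LinearMap.snd ℤ M N)
    exact ⟨x.2, LinearMap.ext fun y => by simpa using hx (0, y)⟩

theorem Nonsingular.pullback {ψ : Q (-1) N} (h : Nonsingular ψ) (f : M ≃ₗ[ℤ] N) :
    Nonsingular (Q.pullback f.toLinearMap ψ) := by
  constructor
  · rw [injective_iff_map_eq_zero]
    intro x hx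
    have : f x = 0 := h.eq_zero fun y => by
      have := LinearMap.congr_fun hx (f.symm y)
      rw [Q.symm_pullback] at this
      simpa using this
    simpa using this
  · intro g
    obtain ⟨x, hx⟩ := h.exists_symm_eq (g ∘ₗ f.symm.toLinearMap)
    refine ⟨f.symm x, LinearMap.ext fun y => ?_⟩
    rw [Q.symm_pullback]
    simpa using hx (f y)

/-- Adding e to a dual vector keeps the pairing with e and switches the refinement, because q(e) = 0
and the two pair to 1. -/
theorem Nonsingular.exists_hyperbolic_pair {ψ : Q (-1) M} (h : Nonsingular ψ) {e : M}
    (he : Primitive e) (hq : Q.quad ψ e = 0) : ∃ f, Q.symm ψ e f = 1 ∧ Q.quad ψ f = 0 := by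
  obtain ⟨f, hf⟩ := h.exists_dual_vector he
  have hf' : Q.symm ψ e (-f) = 1 := by rw [map_neg, ← Q.symm_neg_swap, hf]
  by_cases h0 : Q.quad ψ (-f) = 0
  · exact ⟨-f, hf', h0⟩
  · have h1 : ∀ c : ZMod 2, c ≠ 0 → c = 1 := by decide
    refine ⟨e + -f, by rw [map_add, Q.symm_self, hf', zero_add], ?_⟩
    rw [Q.quad_add, hq, h1 _ h0, hf']
    decide

/-- A primitive vector with trivial quadratic refinement is the first basis vector of a hyperbolic
plane splitting off orthogonally. -/
theorem Nonsingular.exists_plane_splitting [Module.Free ℤ M] [Module.Finite ℤ M] {ψ : Q (-1) M}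
    (h : Nonsingular ψ) {e : M} (he : Primitive e) (hq : Q.quad ψ e = 0) :
    ∃ (N : Type) (_ : AddCommGroup N) (_ : Module.Free ℤ N) (_ : Module.Finite ℤ N)
      (ψ' : Q (-1) N) (φ : ((ℤ × ℤ) × N) ≃ₗ[ℤ] M), Nonsingular ψ' ∧
      Q.pullback φ.toLinearMap ψ = Q.sum plane ψ' ∧ φ ((1, 0), 0) = e := by
  obtain ⟨f, hef, hf⟩ := h.exists_hyperbolic_pair he hq
  have hfe : Q.symm ψ f e = -1 := by rw [Q.symm_neg_swap, hef]
  let N := LinearMap.ker (Q.symm ψ e) ⊓ LinearMap.ker (Q.symm ψ f)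
  have hN : ∀ x : N, Q.symm ψ e x = 0 ∧ Q.symm ψ f x = 0 := fun x => x.2
  have hN' : ∀ x : N, Q.symm ψ x e = 0 ∧ Q.symm ψ x f = 0 := fun x => by
    rw [Q.symm_neg_swap, (hN x).1, Q.symm_neg_swap ψ x f, (hN x).2]
    simp
  let φ : ((ℤ × ℤ) × N) ≃ₗ[ℤ] M :=
    { toFun := fun x => x.1.1 • e + x.1.2 • f + (x.2 : M)
      map_add' := fun x y => by
        simp only [Prod.fst_add, Prod.snd_add, Submodule.coe_add, add_smul]
        abel
      map_smul' := fun c x => by simp [mul_smul, smul_add]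
      -- For x = a e + b f + n, pairing with e on the left gives b and pairing with f gives -a.
      invFun := fun x => ((-Q.symm ψ f x, Q.symm ψ e x),
        ⟨x + Q.symm ψ f x • e - Q.symm ψ e x • f, by
          constructor <;> simp [hef, hfe]⟩)
      left_inv := fun x => by
        have := hN x.2
        ext <;> simp [hef, hfe, this]
        abel
      right_inv := fun x => by simp }
  have hφ : ∀ x, φ x = x.1.1 • e + x.1.2 • f + (x.2 : M) := fun _ => rfl
  have hpull : Q.pullback φ.toLinearMap ψ = Q.sum plane (Q.pullback N.subtype ψ) := by
    refine Q.pullback_eq_of_symm_quad _ _ _ (fun x y => ?_) fun x => ?_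
    · rw [LinearEquiv.coe_coe, hφ, hφ, Q.symm_sum, Q.symm_pullback]
      simp [hN, hN', hef, hfe]
      ring
    · rw [LinearEquiv.coe_coe, hφ, Q.quad_add, Q.quad_add, Q.quad_smul, Q.quad_smul, hq, hf]
      simp [hN, hef, mul_comm]
  refine ⟨N, inferInstance, inferInstance, inferInstance, _, φ, ?_, hpull, by simp [hφ]⟩
  exact Nonsingular.of_sum (hpull ▸ h.pullback φ)

end Plane

/-! ### Lagrangians modulo `2` -/

section ModTwo

variable {M : Type} [AddCommGroup M] {ψ : Q (-1) M} {Λ : Set M}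

/-- `Λ` is the preimage in `M` of a Lagrangian of `M / 2 M`. -/
structure IsModTwoLagrangian (ψ : Q (-1) M) (Λ : Set M) : Prop where
  mem_iff : ∀ x, x ∈ Λ ↔ ∀ y ∈ Λ, Even (Q.symm ψ x y)
  quad_eq_zero : ∀ x ∈ Λ, Q.quad ψ x = 0

theorem IsModTwoLagrangian.add_mem (h : IsModTwoLagrangian ψ Λ) {x y : M} (hx : x ∈ Λ)
    (hy : y ∈ Λ) : x + y ∈ Λ :=
  (h.mem_iff _).2 fun z hz => by
    rw [map_add, LinearMap.add_apply]
    exact ((h.mem_iff x).1 hx z hz).add ((h.mem_iff y).1 hy z hz)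

theorem IsModTwoLagrangian.two_smul_mem (h : IsModTwoLagrangian ψ Λ) (x : M) :
    (2 : ℤ) • x ∈ Λ :=
  (h.mem_iff _).2 fun z _ => by
    rw [map_smul, LinearMap.smul_apply, smul_eq_mul]
    exact even_two_mul _

theorem IsModTwoLagrangian.pullback {N : Type} [AddCommGroup N] (h : IsModTwoLagrangian ψ Λ)
    (f : N ≃ₗ[ℤ] M) : IsModTwoLagrangian (Q.pullback f.toLinearMap ψ) (f ⁻¹' Λ) where
  mem_iff x := by
    rw [Set.mem_preimage, h.mem_iff]
    constructor
    · intro hx y hy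
      rw [Q.symm_pullback]
      exact hx _ hy
    · intro hx y hy
      have := hx (f.symm y) (by simpa using hy)
      rw [Q.symm_pullback] at this
      simpa using this
  quad_eq_zero x hx := by
    rw [Q.quad_pullback]
    exact h.quad_eq_zero _ hx

/-- The set is L + 2M. It is its own annihilator modulo 2 because a vector pairing evenly with L is
congruent modulo 2 to one of L^⊥ = L. -/
theorem IsLagrangian.isModTwoLagrangian {L : Submodule ℤ M} (h : Nonsingular ψ)
    (hL : IsLagrangian ψ L) : IsModTwoLagrangian ψ {x | ∃ y, x - (2 : ℤ) • y ∈ L} where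
  mem_iff x := by
    constructor
    · rintro ⟨y, hy⟩ x' ⟨y', hy'⟩
      have h0 := hL.symm_eq_zero hy hy'
      simp only [map_sub, map_smul, LinearMap.sub_apply, LinearMap.smul_apply, smul_eq_mul] at h0
      rw [Int.even_iff]
      omega
    · intro hx
      have := h.exists_sub_two_smul_mem_annihilator hL.summand (x := x) fun v hv =>
        hx v ⟨0, by simpa using hv⟩
      rwa [hL.annihilator_eq] at this
  quad_eq_zero x := by
    rintro ⟨y, hy⟩
    have := hL.quad_eq_zero hy
    rwa [sub_eq_add_neg, ← smul_neg, Q.quad_add_two_smul] at this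

/-- A Lagrangian modulo `2` survives the removal of a hyperbolic plane. -/
theorem IsModTwoLagrangian.of_plane_sum {Λ : Set ((ℤ × ℤ) × M)}
    (h : IsModTwoLagrangian (Q.sum plane ψ) Λ) :
    IsModTwoLagrangian ψ {m | ∃ a : ℤ, ((a, 0), m) ∈ Λ} where
  mem_iff m := by
    constructor
    · rintro ⟨a, ha⟩ m' ⟨a', ha'⟩
      simpa using (h.mem_iff _).1 ha _ ha'
    · intro hm
      -- Since 2M ⊆ Λ, an even second plane coordinate can be replaced by 0, so y.2 lies in the
      -- reduced set.
      have key : ∀ y ∈ Λ, Even y.1.2 → Even (Q.symm ψ m y.2) := by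
        rintro ⟨⟨a, b⟩, y⟩ hy ⟨k, hk⟩
        refine hm y ⟨a, ?_⟩
        have := h.add_mem hy (h.two_smul_mem ((0, -k), 0))
        simp only at hk
        convert this using 1
        ext <;> simp
        omega
      by_cases hall : ∀ y ∈ Λ, Even y.1.2
      · exact ⟨0, (h.mem_iff _).2 fun y hy => by simpa using key y hy (hall y hy)⟩
      · push Not at hall
        obtain ⟨z, hz, hzo⟩ := hall
        -- The plane coordinate is chosen so that the new vector pairs evenly with z, which has odd
        -- second coordinate. For another such y, the sum y + z has even second coordinate and falls
        -- under `key`.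
        refine ⟨Q.symm ψ m z.2, (h.mem_iff _).2 fun y hy => ?_⟩
        simp only [Q.symm_sum, symm_plane, zero_mul, sub_zero]
        rcases Int.even_or_odd y.1.2 with he | ho
        · exact (he.mul_left _).add (key y hy he)
        · have h1 := key _ (h.add_mem hy hz) (by
            rw [Int.not_even_iff_odd] at hzo
            exact ho.add_odd hzo)
          rw [Prod.snd_add, map_add] at h1
          obtain ⟨k, hk⟩ := ho
          obtain ⟨l, hl⟩ := h1
          rw [hk, Int.even_iff]
          have h2 : Q.symm ψ m y.2 = l + l - Q.symm ψ m z.2 := by omega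
          rw [h2]
          ring_nf
          omega
  quad_eq_zero m := by
    rintro ⟨a, ha⟩
    simpa using h.quad_eq_zero _ ha

end ModTwo

/-! ### Vectors that are primitive modulo a summand and modulo its annihilator -/

section Choice

theorem exists_congr_of_primes {M : Type} [AddCommGroup M] (S : Finset ℕ)
    (hS : ∀ p ∈ S, p.Prime) (t : ℕ → M) : ∃ e : M, ∀ p ∈ S, ∃ z, e = t p + (p : ℤ) • z := by
  induction S using Finset.induction_on with
  | empty => exact ⟨0, by simp⟩
  | insert p S hp ih =>
    obtain ⟨e, he⟩ := ih fun q hq => hS q (Finset.mem_insert_of_mem hq)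
    have hcop : IsCoprime (p : ℤ) ((∏ q ∈ S, q : ℕ) : ℤ) := by
      rw [Nat.isCoprime_iff_coprime]
      refine Nat.Coprime.prod_right fun q hq => ?_
      refine (Nat.coprime_primes (hS p (Finset.mem_insert_self _ _))
        (hS q (Finset.mem_insert_of_mem hq))).2 ?_
      rintro rfl
      exact hp hq
    obtain ⟨a, b, hab⟩ := hcop
    -- Chinese remainder theorem: the coefficients sum to 1, the first is divisible by p and the
    -- second by every q in S.
    refine ⟨(a * p) • e + (b * (∏ q ∈ S, q : ℕ)) • t p, fun q hq => ?_⟩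
    rcases Finset.mem_insert.1 hq with rfl | hq
    · refine ⟨a • (e - t q), ?_⟩
      linear_combination (norm := module) hab • t q
    · obtain ⟨z, hz⟩ := he q hq
      obtain ⟨c, hc⟩ : q ∣ ∏ q ∈ S, q := Finset.dvd_prod_of_mem _ hq
      have h2 : (q : ℤ) * (b * c) = b * (∏ q ∈ S, q : ℕ) := by rw [hc]; push_cast; ring
      refine ⟨z + (b * c) • (t p - e), ?_⟩
      rw [smul_add, ← add_assoc, ← hz, smul_smul, h2]
      linear_combination (norm := module) hab • e

/-- A functional on a module of rank at least `2` which vanishes modulo no prime divisor of `k` is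
congruent modulo `k` to a primitive one. -/
theorem exists_add_smul_eq_one {X : Type} [AddCommGroup X] [Module.Free ℤ X] [Module.Finite ℤ X]
    {α : Module.Dual ℤ X} (hα : α ≠ 0) {k : ℤ}
    (hk : ∀ p : ℕ, p.Prime → (p : ℤ) ∣ k → ∃ v, ¬(p : ℤ) ∣ α v)
    (hX : ∀ v : X, ∃ v', ∀ c : ℤ, v' ≠ c • v) :
    ∃ (β : Module.Dual ℤ X) (v : X), α v + k * β v = 1 := by
  obtain ⟨c, α₀, hc, rfl, g, hg⟩ := exists_eq_smul_primitive hα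
  obtain ⟨v₀, rfl⟩ := (Module.evalEquiv ℤ X).surjective g
  simp only [Module.evalEquiv_apply, Module.Dual.eval_apply] at hg
  -- A prime dividing both c and k would divide every value of α = c α₀.
  have hcop : IsCoprime c k := by
    rw [Int.isCoprime_iff_gcd_eq_one]
    by_contra hne
    obtain ⟨p, hp, hpd⟩ := Nat.exists_prime_and_dvd hne
    have hpd' := Int.natCast_dvd_natCast.2 hpd
    obtain ⟨v, hv⟩ := hk p hp (hpd'.trans (Int.gcd_dvd_right c k))
    exact hv (by
      rw [LinearMap.smul_apply, smul_eq_mul]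
      exact (hpd'.trans (Int.gcd_dvd_left c k)).mul_right _)
  -- Rank at least 2 provides a primitive v₁ in the kernel of α₀.
  obtain ⟨v', hv'⟩ := hX v₀
  have hne : v' - α₀ v' • v₀ ≠ 0 := fun h => hv' _ (sub_eq_zero.1 h)
  obtain ⟨d, v₁, hd, hdv, g, hg1⟩ := exists_eq_smul_primitive hne
  have hα₁ : α₀ v₁ = 0 := by
    have := congrArg α₀ hdv
    simp only [map_sub, map_smul, hg, smul_eq_mul, mul_one, sub_self] at this
    exact (mul_eq_zero.1 this.symm).resolve_left hd
  obtain ⟨a, b, hab⟩ := hcop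
  -- This β is 0 on v₀ and 1 on v₁, so the value is a c + b k, the Bézout combination equal to 1.
  refine ⟨g - g v₀ • α₀, a • v₀ + b • v₁, ?_⟩
  simp [hg, hg1, hα₁]
  linarith

/-- An injection into a free module has a left inverse up to a nonzero multiple. -/
theorem exists_left_inverse_smul {X M : Type} [AddCommGroup X] [AddCommGroup M]
    [Module.Free ℤ M] [Module.Finite ℤ M] (j : X →ₗ[ℤ] M) (hj : Function.Injective j) :
    ∃ (k : ℤ) (r : M →ₗ[ℤ] X), k ≠ 0 ∧ ∀ x, r (j x) = k • x := by
  classical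
  obtain ⟨n, bM, bN, f, a, snf⟩ :=
    Submodule.smithNormalForm (Module.finBasis ℤ M) (LinearMap.range j)
  let φ := LinearEquiv.ofInjective j hj
  have ha : ∀ i, a i ≠ 0 := fun i h => bN.ne_zero i (Subtype.ext (by rw [snf, h, zero_smul]; rfl))
  -- In Smith normal form j is diagonal with entries a i. The i-th basis vector of the image is sent
  -- back with the product of the other entries, which makes the common multiple k the product of
  -- all entries.
  let r : M →ₗ[ℤ] X := bM.constr ℤ fun i =>
    if h : ∃ l, f l = i then (∏ m ∈ Finset.univ.erase h.choose, a m) • φ.symm (bN h.choose) else 0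
  refine ⟨∏ m, a m, r, Finset.prod_ne_zero_iff.2 fun i _ => ha i, ?_⟩
  have hr : r ∘ₗ (LinearMap.range j).subtype = (∏ m, a m) • φ.symm.toLinearMap := by
    refine bN.ext fun i => ?_
    have hch : ∀ h : ∃ l, f l = f i, h.choose = i := fun h => f.injective h.choose_spec
    have hex : ∃ l, f l = f i := ⟨i, rfl⟩
    simp only [LinearMap.comp_apply, Submodule.subtype_apply, snf, map_smul, r,
      Module.Basis.constr_basis, hex, dif_pos, hch, LinearMap.smul_apply, LinearEquiv.coe_coe]
    rw [smul_smul, Finset.mul_prod_erase _ _ (Finset.mem_univ i)]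
  intro x
  have := LinearMap.congr_fun hr (φ x)
  simpa [φ] using this

variable {M : Type} [AddCommGroup M] {ψ : Q (-1) M}

/-- If x vanishes modulo p on W and y on V, then x + y vanishes on neither. The candidates are
listed explicitly so that z stays in any set closed under addition containing x and y, such as Λ. -/
theorem exists_not_dvd_on_both {p : ℤ} {x y : M} {V W : Submodule ℤ M}
    (hx : ∃ v ∈ V, ¬p ∣ Q.symm ψ x v) (hy : ∃ w ∈ W, ¬p ∣ Q.symm ψ y w) :
    ∃ z, (z = x ∨ z = y ∨ z = x + y) ∧
      (∃ v ∈ V, ¬p ∣ Q.symm ψ z v) ∧ ∃ w ∈ W, ¬p ∣ Q.symm ψ z w := by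
  by_cases h1 : ∃ w ∈ W, ¬p ∣ Q.symm ψ x w
  · exact ⟨x, Or.inl rfl, hx, h1⟩
  by_cases h2 : ∃ v ∈ V, ¬p ∣ Q.symm ψ y v
  · exact ⟨y, Or.inr (Or.inl rfl), h2, hy⟩
  push Not at h1 h2
  obtain ⟨v, hv, hxv⟩ := hx
  obtain ⟨w, hw, hyw⟩ := hy
  refine ⟨x + y, Or.inr (Or.inr rfl), ⟨v, hv, ?_⟩, ⟨w, hw, ?_⟩⟩
  · rwa [map_add, LinearMap.add_apply, dvd_add_left (h2 v hv)]
  · rwa [map_add, LinearMap.add_apply, dvd_add_right (h1 w hw)]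

/-- If V pairs evenly with Λ, then V ⊆ Λ, so V pairs evenly with itself and v is congruent modulo 2
to a vector of W. A dual vector e of v then pairs oddly with both. If q(e) ≠ 0, adding v repairs it,
because q(v) = 0 and e pairs to 1 with v. -/
theorem exists_odd_of_even {Λ : Set M} (h : Nonsingular ψ) (hΛ : IsModTwoLagrangian ψ Λ)
    {V W : Submodule ℤ M} (hV : IsSummand V) (hVW : annihilator ψ V = W)
    {v : M} (hv : v ∈ V) (hvp : Primitive v) (hev : ∀ x ∈ Λ, ∀ v ∈ V, Even (Q.symm ψ x v)) :
    ∃ e, Q.quad ψ e = 0 ∧ (∃ v ∈ V, ¬(2 : ℤ) ∣ Q.symm ψ e v) ∧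
      ∃ w ∈ W, ¬(2 : ℤ) ∣ Q.symm ψ e w := by
  obtain ⟨e, he⟩ := h.exists_dual_vector hvp
  have hvΛ : v ∈ Λ := (hΛ.mem_iff v).2 fun y hy => by
    rw [Q.symm_neg_swap]
    exact (hev y hy v hv).neg
  obtain ⟨y, hy⟩ := h.exists_sub_two_smul_mem_annihilator hV (hev v hvΛ)
  rw [hVW] at hy
  have key : ∀ c : ℤ, (∃ u ∈ V, ¬(2 : ℤ) ∣ Q.symm ψ (e + c • v) u) ∧
      ∃ w ∈ W, ¬(2 : ℤ) ∣ Q.symm ψ (e + c • v) w := fun c => by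
    refine ⟨⟨v, hv, ?_⟩, ⟨_, hy, ?_⟩⟩
    · simp [he]
    · simp only [map_add, map_smul, map_sub, LinearMap.add_apply, LinearMap.smul_apply,
        Q.symm_self, he, smul_eq_mul, mul_zero]
      have : 1 - 2 * Q.symm ψ e y + c * (0 - 2 * Q.symm ψ v y) =
        1 + 2 * (-Q.symm ψ e y - c * Q.symm ψ v y) := by ring
      omega
  by_cases h0 : Q.quad ψ e = 0
  · exact ⟨e, h0, by simpa using key 0⟩
  · have h1 : ∀ c : ZMod 2, c ≠ 0 → c = 1 := by decide
    refine ⟨e + (1 : ℤ) • v, ?_, key 1⟩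
    rw [one_smul, Q.quad_add, h1 _ h0, hΛ.quad_eq_zero v hvΛ, he]
    decide

/-- The local problem at 2, the only prime at which the refinement matters. If neither V nor V^⊥
pairs evenly with Λ, the vector can be found inside Λ, where q vanishes. -/
theorem exists_odd_on_both [Module.Free ℤ M] [Module.Finite ℤ M] {Λ : Set M}
    (h : Nonsingular ψ) (hΛ : IsModTwoLagrangian ψ Λ)
    {V : Submodule ℤ M} (hV : IsSummand V) {v w : M} (hv : v ∈ V) (hvp : Primitive v)
    (hw : w ∈ annihilator ψ V) (hwp : Primitive w) :
    ∃ e, Q.quad ψ e = 0 ∧ (∃ v ∈ V, ¬(2 : ℤ) ∣ Q.symm ψ e v) ∧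
      ∃ w ∈ annihilator ψ V, ¬(2 : ℤ) ∣ Q.symm ψ e w := by
  by_cases h1 : ∀ x ∈ Λ, ∀ v ∈ V, Even (Q.symm ψ x v)
  · exact exists_odd_of_even h hΛ hV rfl hv hvp h1
  by_cases h2 : ∀ x ∈ Λ, ∀ v ∈ annihilator ψ V, Even (Q.symm ψ x v)
  · obtain ⟨e, he, heV, heW⟩ := exists_odd_of_even h hΛ (isSummand_annihilator ψ V)
      (h.annihilator_annihilator hV) hw hwp h2
    exact ⟨e, he, heW, heV⟩
  push Not at h1 h2
  obtain ⟨x, hx, v, hv, hxv⟩ := h1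
  obtain ⟨y, hy, w, hw, hyw⟩ := h2
  rw [even_iff_two_dvd] at hxv hyw
  obtain ⟨z, hz, hzz⟩ := exists_not_dvd_on_both (ψ := ψ) ⟨v, hv, hxv⟩ ⟨w, hw, hyw⟩
  refine ⟨z, hΛ.quad_eq_zero z ?_, hzz⟩
  rcases hz with rfl | rfl | rfl
  exacts [hx, hy, hΛ.add_mem hx hy]

variable [Module.Free ℤ M] [Module.Finite ℤ M]

/-- Functionals on two summands meeting in `0` are jointly represented up to a nonzero multiple. -/
theorem Nonsingular.exists_smul_symm_eq_on (h : Nonsingular ψ) {V W : Submodule ℤ M}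
    (hVW : Disjoint V W) : ∃ k : ℤ, k ≠ 0 ∧ ∀ (α : Module.Dual ℤ V) (β : Module.Dual ℤ W),
      ∃ m, (∀ v : V, Q.symm ψ m v = k * α v) ∧ ∀ w : W, Q.symm ψ m w = k * β w := by
  let j : V × W →ₗ[ℤ] M := V.subtype.coprod W.subtype
  have hj : Function.Injective j := by
    rw [← LinearMap.ker_eq_bot, LinearMap.ker_coprod_of_disjoint_range]
    · simp
    · simpa using hVW
  obtain ⟨k, r, hk, hr⟩ := exists_left_inverse_smul j hj
  refine ⟨k, hk, fun α β => ?_⟩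
  obtain ⟨m, hm⟩ := h.exists_symm_eq (α.coprod β ∘ₗ r)
  refine ⟨m, fun v => ?_, fun w => ?_⟩
  · have := hr (v, 0)
    simp only [j, LinearMap.coprod_apply, map_zero, add_zero, Submodule.subtype_apply] at this
    simp [hm, this]
  · have := hr (0, w)
    simp only [j, LinearMap.coprod_apply, map_zero, zero_add, Submodule.subtype_apply] at this
    simp [hm, this]

/-- Local to global. Let k be such that all pairs (kα, kβ) of functionals on V and W = V^⊥ are
pairings with one vector. Solutions modulo the primes dividing 2k are glued to e₁; its restrictions
to V and W are then congruent modulo 2k to functionals taking the value 1, and both corrections come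
from a single double 2m, which does not affect q. -/
theorem exists_dual_on_both_of_disjoint {Λ : Set M} (h : Nonsingular ψ)
    (hΛ : IsModTwoLagrangian ψ Λ) {V : Submodule ℤ M} (hV : IsSummand V)
    (hVW : Disjoint V (annihilator ψ V)) (hV0 : V ≠ ⊥) (hW0 : annihilator ψ V ≠ ⊥) :
    ∃ e, Q.quad ψ e = 0 ∧ (∃ v ∈ V, Q.symm ψ e v = 1) ∧
      ∃ w ∈ annihilator ψ V, Q.symm ψ e w = 1 := by
  have hprim : ∀ {V : Submodule ℤ M}, IsSummand V → V ≠ ⊥ → ∃ v ∈ V, Primitive v := by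
    intro V hV hV0
    obtain ⟨v, hv, hv0⟩ := V.ne_bot_iff.1 hV0
    obtain ⟨-, y, -, -, hy, hyV⟩ := exists_primitive_mem hV hv hv0
    exact ⟨y, hyV, hy⟩
  -- If every vector of V were a multiple of v, then v would lie in V ∩ V^⊥ = 0, because the form is
  -- alternating.
  have hrank : ∀ {V : Submodule ℤ M}, V ≠ ⊥ → Disjoint V (annihilator ψ V) →
      ∀ v : V, ∃ v' : V, ∀ c : ℤ, v' ≠ c • v := by
    intro V hV0 hd v
    by_contra! hall
    have hv : (v : M) ∈ annihilator ψ V := fun y hy => by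
      obtain ⟨c, hc⟩ := hall ⟨y, hy⟩
      have : y = c • (v : M) := congrArg Subtype.val hc
      rw [this, map_smul, Q.symm_self, smul_zero]
    obtain ⟨y, hy, hy0⟩ := V.ne_bot_iff.1 hV0
    obtain ⟨c, hc⟩ := hall ⟨y, hy⟩
    have : y = c • (v : M) := congrArg Subtype.val hc
    rw [Submodule.disjoint_def.1 hd v v.2 hv, smul_zero] at this
    exact hy0 this
  set W := annihilator ψ V with hW
  have hWs : IsSummand W := isSummand_annihilator ψ V
  have hWd : Disjoint W (annihilator ψ W) := by
    rw [hW, h.annihilator_annihilator hV]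
    exact hVW.symm
  obtain ⟨v₀, hv₀, hv₀p⟩ := hprim hV hV0
  obtain ⟨w₀, hw₀, hw₀p⟩ := hprim hWs hW0
  obtain ⟨e₀, he₀, he₀VW⟩ := exists_odd_on_both h hΛ hV hv₀ hv₀p hw₀ hw₀p
  obtain ⟨k, hk, hkm⟩ := h.exists_smul_symm_eq_on hVW
  obtain ⟨x, hx⟩ := h.exists_dual_vector hv₀p
  obtain ⟨y, hy⟩ := h.exists_dual_vector hw₀p
  -- At 2 the vector e₀ is imposed, so that the glued vector inherits its refinement 0; at odd
  -- primes the refinement plays no role.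
  have hloc : ∀ p : ℕ, ∃ z, p.Prime → ((∃ v ∈ V, ¬(p : ℤ) ∣ Q.symm ψ z v) ∧
      ∃ w ∈ W, ¬(p : ℤ) ∣ Q.symm ψ z w) ∧ (p = 2 → z = e₀) := by
    intro p
    by_cases hp : p.Prime
    · by_cases hp2 : p = 2
      · subst hp2
        exact ⟨e₀, fun _ => ⟨he₀VW, fun _ => rfl⟩⟩
      · have hp1 : ¬(p : ℤ) ∣ 1 := fun hd =>
          (Nat.prime_iff_prime_int.1 hp).not_isUnit (isUnit_of_dvd_one hd)
        obtain ⟨z, -, hz⟩ := exists_not_dvd_on_both (ψ := ψ) (p := p) (V := V) (W := W)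
          ⟨v₀, hv₀, by rwa [hx]⟩ ⟨w₀, hw₀, by rwa [hy]⟩
        exact ⟨z, fun _ => ⟨hz, fun h => absurd h hp2⟩⟩
    · exact ⟨0, fun h => absurd h hp⟩
  choose t ht using hloc
  have hk0 : (2 * k).natAbs ≠ 0 := by omega
  obtain ⟨e₁, he₁⟩ := exists_congr_of_primes (2 * k).natAbs.primeFactors
    (fun p hp => Nat.prime_of_mem_primeFactors hp) t
  have hmem : ∀ p : ℕ, p.Prime → (p : ℤ) ∣ 2 * k → p ∈ (2 * k).natAbs.primeFactors :=
    fun p hp hd => Nat.mem_primeFactors.2 ⟨hp, Int.natCast_dvd.1 hd, hk0⟩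
  have hq₁ : Q.quad ψ e₁ = 0 := by
    obtain ⟨z, hz⟩ := he₁ 2 (hmem 2 Nat.prime_two (by simp))
    rw [hz, (ht 2 Nat.prime_two).2 rfl, Nat.cast_ofNat, Q.quad_add_two_smul, he₀]
  have hgood : ∀ p : ℕ, p.Prime → (p : ℤ) ∣ 2 * k → (∃ v ∈ V, ¬(p : ℤ) ∣ Q.symm ψ e₁ v) ∧
      ∃ w ∈ W, ¬(p : ℤ) ∣ Q.symm ψ e₁ w := by
    intro p hp hd
    obtain ⟨z, hz⟩ := he₁ p (hmem p hp hd)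
    have hc : ∀ m, ¬(p : ℤ) ∣ Q.symm ψ (t p) m → ¬(p : ℤ) ∣ Q.symm ψ e₁ m := fun m hm => by
      rwa [hz, map_add, map_smul, LinearMap.add_apply, LinearMap.smul_apply, smul_eq_mul,
        dvd_add_left (dvd_mul_right _ _)]
    obtain ⟨⟨v, hv, hv'⟩, w, hw, hw'⟩ := (ht p hp).1
    exact ⟨⟨v, hv, hc v hv'⟩, w, hw, hc w hw'⟩
  have step : ∀ {V : Submodule ℤ M}, V ≠ ⊥ → Disjoint V (annihilator ψ V) →
      (∀ p : ℕ, p.Prime → (p : ℤ) ∣ 2 * k → ∃ v ∈ V, ¬(p : ℤ) ∣ Q.symm ψ e₁ v) →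
      ∃ (β : Module.Dual ℤ V) (v : V), Q.symm ψ e₁ v + 2 * k * β v = 1 := by
    intro V hV0 hd hg
    have hα : Q.symm ψ e₁ ∘ₗ V.subtype ≠ 0 := fun h0 => by
      obtain ⟨v, hv, hv'⟩ := hg 2 Nat.prime_two (by simp)
      exact hv' (by rw [show Q.symm ψ e₁ v = 0 from LinearMap.congr_fun h0 ⟨v, hv⟩]; simp)
    exact exists_add_smul_eq_one hα (fun p hp hd => by
      obtain ⟨v, hv, hv'⟩ := hg p hp hd
      exact ⟨⟨v, hv⟩, hv'⟩) (hrank hV0 hd)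
  obtain ⟨α, v, hv⟩ := step hV0 hVW fun p hp hd => (hgood p hp hd).1
  obtain ⟨β, w, hw⟩ := step hW0 hWd fun p hp hd => (hgood p hp hd).2
  obtain ⟨m, hmV, hmW⟩ := hkm α β
  refine ⟨e₁ + (2 : ℤ) • m, by rw [Q.quad_add_two_smul, hq₁], ⟨v, v.2, ?_⟩, w, w.2, ?_⟩
  · rw [map_add, map_smul, LinearMap.add_apply, LinearMap.smul_apply, hmV, smul_eq_mul, ← hv]
    ring
  · rw [map_add, map_smul, LinearMap.add_apply, LinearMap.smul_apply, hmW, smul_eq_mul, ← hw]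
    ring

/-- If r ∈ Λ, adding r to a dual vector switches its refinement. Otherwise some x ∈ Λ pairs oddly
with r, and an even multiple of a dual vector corrects this pairing to 1. -/
theorem exists_dual_quad_eq_zero {M : Type} [AddCommGroup M] {ψ : Q (-1) M} {Λ : Set M} (h : Nonsingular ψ)
    (hΛ : IsModTwoLagrangian ψ Λ) {r : M} (hr : Primitive r) :
    ∃ e, Q.quad ψ e = 0 ∧ Q.symm ψ e r = 1 := by
  obtain ⟨e, he⟩ := h.exists_dual_vector hr
  by_cases hrΛ : r ∈ Λ
  · by_cases h0 : Q.quad ψ e = 0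
    · exact ⟨e, h0, he⟩
    · have h1 : ∀ c : ZMod 2, c ≠ 0 → c = 1 := by decide
      refine ⟨e + r, ?_, by rw [map_add, LinearMap.add_apply, Q.symm_self, he, add_zero]⟩
      rw [Q.quad_add, h1 _ h0, hΛ.quad_eq_zero r hrΛ, he]
      decide
  · rw [hΛ.mem_iff] at hrΛ
    push Not at hrΛ
    obtain ⟨x, hx, hxr⟩ := hrΛ
    rw [Int.not_even_iff_odd, Q.symm_neg_swap, Int.odd_iff] at hxr
    obtain ⟨k, hk⟩ : ∃ k, Q.symm ψ x r = 1 + 2 * k := ⟨(Q.symm ψ x r - 1) / 2, by omega⟩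
    refine ⟨x + (2 : ℤ) • (-k • e), by rw [Q.quad_add_two_smul, hΛ.quad_eq_zero x hx], ?_⟩
    simp only [map_add, map_smul, LinearMap.add_apply, LinearMap.smul_apply, he, hk, smul_eq_mul]
    ring

/-- If V meets V^⊥, a primitive vector of the intersection serves for both, and no gluing is needed.
-/
theorem exists_dual_on_both {Λ : Set M} (h : Nonsingular ψ)
    (hΛ : IsModTwoLagrangian ψ Λ) {V : Submodule ℤ M} (hV : IsSummand V)
    (hV0 : V ≠ ⊥) (hW0 : annihilator ψ V ≠ ⊥) :
    ∃ e, Q.quad ψ e = 0 ∧ (∃ v ∈ V, Q.symm ψ e v = 1) ∧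
      ∃ w ∈ annihilator ψ V, Q.symm ψ e w = 1 := by
  by_cases hVW : Disjoint V (annihilator ψ V)
  · exact exists_dual_on_both_of_disjoint h hΛ hV hVW hV0 hW0
  · rw [Submodule.disjoint_def] at hVW
    push Not at hVW
    obtain ⟨x, hx, hx', hx0⟩ := hVW
    obtain ⟨c, r, hc, rfl, hr, hrV⟩ := exists_primitive_mem hV hx hx0
    have hrW := isSummand_iff_saturated.1 (isSummand_annihilator ψ V) c r hc hx'
    obtain ⟨e, he, her⟩ := exists_dual_quad_eq_zero h hΛ hr
    exact ⟨e, he, ⟨r, hrV, her⟩, r, hrW, her⟩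

end Choice

/-! ### Lagrangian complements -/

section Complement

theorem primitive_of_symm_left {M : Type} [AddCommGroup M] {ψ : Q (-1) M} {x y : M}
    (h : Q.symm ψ x y = 1) : Primitive x :=
  primitive_of_symm_eq_one (ψ := ψ) (y := -y) (by
    rw [map_neg, LinearMap.neg_apply, ← Q.symm_neg_swap, h])

theorem isLagrangian_of_subsingleton {M : Type} [AddCommGroup M] [Subsingleton M]
    [Module.Free ℤ M] [Module.Finite ℤ M] (ψ : Q (-1) M) (L : Submodule ℤ M) :
    IsLagrangian ψ L :=
  isLagrangian_of (Subsingleton.elim _ _) fun x _ => by rw [Subsingleton.elim x 0, Q.quad_zero]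

theorem IsSummand.comap {M N : Type} [AddCommGroup M] [Module.Free ℤ M] [Module.Finite ℤ M]
    [AddCommGroup N] [Module.Free ℤ N] [Module.Finite ℤ N] {V : Submodule ℤ N} (hV : IsSummand V)
    (f : M →ₗ[ℤ] N) : IsSummand (V.comap f) :=
  isSummand_iff_saturated.2 fun c x hc hx => isSummand_iff_saturated.1 hV c _ hc (by
    simpa using hx)

theorem finrank_plane_prod {M N : Type} [AddCommGroup M] [AddCommGroup N] [Module.Free ℤ N]
    [Module.Finite ℤ N] (φ : ((ℤ × ℤ) × N) ≃ₗ[ℤ] M) :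
    Module.finrank ℤ M = Module.finrank ℤ N + 2 := by
  rw [← φ.finrank_eq, Module.finrank_prod, Module.finrank_prod, Module.finrank_self]
  omega

/-! ### Reducing a summand along a hyperbolic plane -/

section Reduction

variable {N : Type} [AddCommGroup N] (V : Submodule ℤ ((ℤ × ℤ) × N))

/-- The projection to `N` of the part of `V` in `(ℤ ⊕ 0) ⊕ N`. -/
def planeReduction : Submodule ℤ N :=
  LinearMap.range (LinearMap.snd ℤ (ℤ × ℤ) N ∘ₗ V.subtype ∘ₗ
    (LinearMap.ker (LinearMap.snd ℤ ℤ ℤ ∘ₗ LinearMap.fst ℤ (ℤ × ℤ) N ∘ₗ V.subtype)).subtype)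

variable {V}

theorem mem_planeReduction {m : N} : m ∈ planeReduction V ↔ ∃ a : ℤ, ((a, 0), m) ∈ V := by
  constructor
  · rintro ⟨⟨⟨⟨⟨a, b⟩, m⟩, hV⟩, hb⟩, rfl⟩
    obtain rfl : b = 0 := hb
    exact ⟨a, hV⟩
  · rintro ⟨a, ha⟩
    exact ⟨⟨⟨_, ha⟩, rfl⟩, rfl⟩

variable {ψ : Q (-1) N} {w : (ℤ × ℤ) × N}

/-- A vector w of V^⊥ pairing to 1 with the first basis vector prevents V from containing any
nonzero multiple of it. This is why e must pair to 1 with V^⊥ and not only with V. -/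
theorem eq_zero_of_mem_plane (hw : w ∈ annihilator (Q.sum plane ψ) V) (hw1 : w.1.2 = 1) {a : ℤ}
    (ha : ((a, 0), 0) ∈ V) : a = 0 := by
  simpa [hw1] using hw _ ha

theorem isSummand_planeReduction [Module.Free ℤ N] [Module.Finite ℤ N] (hV : IsSummand V)
    (hw : w ∈ annihilator (Q.sum plane ψ) V) (hw1 : w.1.2 = 1) :
    IsSummand (planeReduction V) := by
  refine isSummand_iff_saturated.2 fun c m hc hm => ?_
  rw [mem_planeReduction] at hm ⊢
  obtain ⟨a, ha⟩ := hm
  have h0 := hw _ ha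
  simp only [Q.symm_sum, symm_plane, hw1, map_smul, smul_eq_mul, mul_zero, one_mul, zero_sub] at h0
  -- Orthogonality to w forces a = c · (w.2 paired with m), so the plane coordinate is divisible by
  -- c as well.
  refine ⟨Q.symm ψ w.2 m, isSummand_iff_saturated.1 hV c _ hc ?_⟩
  convert ha using 1
  ext <;> simp
  linarith

/-- The vector v makes the second plane coordinate of V surjective onto ℤ, and w makes its kernel
inject into N. -/
theorem finrank_planeReduction [Module.Free ℤ N] [Module.Finite ℤ N]
    (hw : w ∈ annihilator (Q.sum plane ψ) V) (hw1 : w.1.2 = 1) {v : (ℤ × ℤ) × N} (hv : v ∈ V)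
    (hv1 : v.1.2 = 1) : Module.finrank ℤ V = Module.finrank ℤ (planeReduction V) + 1 := by
  rw [planeReduction, LinearMap.finrank_range_of_inj]
  · have hs : Function.Surjective
        (LinearMap.snd ℤ ℤ ℤ ∘ₗ LinearMap.fst ℤ (ℤ × ℤ) N ∘ₗ V.subtype) :=
      fun c => ⟨c • ⟨v, hv⟩, by simp [hv1]⟩
    rw [← Submodule.finrank_quotient_add_finrank
      (LinearMap.ker (LinearMap.snd ℤ ℤ ℤ ∘ₗ LinearMap.fst ℤ (ℤ × ℤ) N ∘ₗ V.subtype)),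
      (LinearMap.quotKerEquivOfSurjective _ hs).finrank_eq, Module.finrank_self, add_comm]
  · rw [injective_iff_map_eq_zero]
    rintro ⟨⟨⟨⟨a, b⟩, m⟩, hV⟩, hb⟩ hm
    obtain rfl : b = 0 := hb
    obtain rfl : m = 0 := hm
    obtain rfl := eq_zero_of_mem_plane hw hw1 hV
    rfl

theorem isCompl_of_planeReduction (hw : w ∈ annihilator (Q.sum plane ψ) V) (hw1 : w.1.2 = 1)
    {v : (ℤ × ℤ) × N} (hv : v ∈ V) (hv1 : v.1.2 = 1) {K : Submodule ℤ N}
    (hK : IsCompl K (planeReduction V)) : IsCompl (planeL.prod K) V := by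
  constructor
  · rw [Submodule.disjoint_def]
    rintro ⟨⟨a, b⟩, m⟩ ⟨hb, hm⟩ hx
    obtain rfl : b = 0 := mem_planeL.1 hb
    obtain rfl : m = 0 :=
      Submodule.disjoint_def.1 hK.disjoint m hm (mem_planeReduction.2 ⟨a, hx⟩)
    obtain rfl := eq_zero_of_mem_plane hw hw1 hx
    rfl
  · rw [codisjoint_iff, eq_top_iff]
    rintro x -
    -- Subtracting a multiple of v clears the second plane coordinate; the N-part is then split, and
    -- the leftover first coordinate is absorbed by `planeL`.
    have hx : (x - x.1.2 • v).2 ∈ K ⊔ planeReduction V := by rw [hK.sup_eq_top]; trivial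
    obtain ⟨k, hk, m, hm, hkm⟩ := Submodule.mem_sup.1 hx
    obtain ⟨a, ha⟩ := mem_planeReduction.1 hm
    refine Submodule.mem_sup.2 ⟨((x.1.1 - x.1.2 * v.1.1 - a, 0), k), ⟨mem_planeL.2 rfl, hk⟩,
      ((a, 0), m) + x.1.2 • v, V.add_mem ha (V.smul_mem _ hv), ?_⟩
    simp only [Prod.snd_sub, Prod.smul_snd] at hkm
    refine Prod.ext (Prod.ext ?_ ?_) ?_
    · simp
      ring
    · simp [hv1]
    · rw [Prod.snd_add, Prod.snd_add, ← add_assoc]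
      simp [hkm]

end Reduction

theorem IsLagrangian.map_plane_prod {M N : Type} [AddCommGroup M] [AddCommGroup N]
    [Module.Free ℤ M] [Module.Finite ℤ M] {ψ : Q (-1) M} {ψ' : Q (-1) N}
    {φ : ((ℤ × ℤ) × N) ≃ₗ[ℤ] M} (hφ : Q.pullback φ.toLinearMap ψ = Q.sum plane ψ')
    {K : Submodule ℤ N} (hK : IsLagrangian ψ' K) :
    IsLagrangian ψ ((planeL.prod K).map φ.toLinearMap) :=
  IsLagrangian.map φ (hφ ▸ planeL_lagrangian.prod hK)

/-- Every half rank summand has a Lagrangian complement. -/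
theorem exists_isLagrangian_isCompl (n : ℕ) : ∀ {M : Type} [AddCommGroup M] [Module.Free ℤ M]
    [Module.Finite ℤ M] {ψ : Q (-1) M} {Λ : Set M} {V : Submodule ℤ M}, Nonsingular ψ →
    IsModTwoLagrangian ψ Λ → IsSummand V → Module.finrank ℤ V = n → Module.finrank ℤ M = 2 * n →
    ∃ K, IsLagrangian ψ K ∧ IsCompl K V := by
  induction n with
  | zero =>
    intro M _ _ _ ψ Λ V _ _ _ _ hM
    have : Subsingleton M := Module.finrank_zero_iff.1 hM
    exact ⟨⊥, isLagrangian_of_subsingleton ψ ⊥, by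
      rw [Subsingleton.elim V ⊤]
      exact isCompl_bot_top⟩
  | succ n ih =>
    intro M _ _ _ ψ Λ V h hΛ hV hVn hM
    have hV0 : V ≠ ⊥ := by
      rintro rfl
      simp at hVn
    have hW0 : annihilator ψ V ≠ ⊥ := by
      intro h0
      have h1 := h.annihilator_annihilator hV
      rw [h0] at h1
      have h2 : (⊤ : Submodule ℤ M) ≤ V := h1 ▸ fun x _ y hy => by
        rw [(Submodule.mem_bot ℤ).1 hy, map_zero]
      rw [top_le_iff.1 h2, finrank_top] at hVn
      omega
    obtain ⟨e, heq, ⟨v, hv, hev⟩, w, hw, hew⟩ := exists_dual_on_both h hΛ hV hV0 hW0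
    obtain ⟨N, _, _, _, ψ', φ, h', hφ, rfl⟩ :=
      h.exists_plane_splitting (primitive_of_symm_left hev) heq
    have hsymm : ∀ x, (φ.symm x).1.2 = Q.symm ψ (φ ((1, 0), 0)) x := fun x => by
      have := Q.symm_pullback φ.toLinearMap ψ ((1, 0), 0) (φ.symm x)
      rw [hφ] at this
      simpa using this
    have hv1 : (φ.symm v).1.2 = 1 := by rw [hsymm, hev]
    have hw1 : (φ.symm w).1.2 = 1 := by rw [hsymm, hew]
    have hv' : φ.symm v ∈ V.comap φ.toLinearMap := by simpa using hv
    have hw' : φ.symm w ∈ annihilator (Q.sum plane ψ') (V.comap φ.toLinearMap) := fun y hy => by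
      rw [← hφ, Q.symm_pullback]
      simpa using hw _ hy
    have hVc : (V.comap φ.toLinearMap).map φ.toLinearMap = V :=
      Submodule.map_comap_eq_of_surjective φ.surjective V
    have hrank : Module.finrank ℤ (V.comap φ.toLinearMap) = n + 1 := by
      rw [← hVn]
      conv_rhs => rw [← hVc]
      exact (φ.submoduleMap (V.comap φ.toLinearMap)).finrank_eq
    have h1 := finrank_planeReduction hw' hw1 hv' hv1
    have h2 := finrank_plane_prod φ
    -- The vector e need not lie in a known Lagrangian, so the inductive hypothesis asks only for a
    -- Lagrangian modulo 2, which descends to N along any such plane.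
    have hΛ' := hΛ.pullback φ
    rw [hφ] at hΛ'
    obtain ⟨K, hK, hKV⟩ := ih h' hΛ'.of_plane_sum
      (isSummand_planeReduction (hV.comap _) hw' hw1) (by omega) (by omega)
    refine ⟨(planeL.prod K).map φ.toLinearMap, hK.map_plane_prod hφ, ?_⟩
    have := isCompl_of_planeReduction hw' hw1 hv' hv1 hKV
    rw [← hVc]
    exact (Submodule.orderIsoMapComap φ).isCompl_iff.1 this

/-- A Lagrangian modulo 2 suffices for an integral one to exist: take a Lagrangian complement of an
arbitrary half rank summand. -/
theorem exists_isLagrangian {n : ℕ} {M : Type} [AddCommGroup M] [Module.Free ℤ M]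
    [Module.Finite ℤ M] {ψ : Q (-1) M} {Λ : Set M} (h : Nonsingular ψ)
    (hΛ : IsModTwoLagrangian ψ Λ) (hM : Module.finrank ℤ M = 2 * n) : ∃ K, IsLagrangian ψ K := by
  let X := Fin n → ℤ
  have hX : Module.finrank ℤ X = n := Module.finrank_fin_fun ℤ
  let f : (X × X) ≃ₗ[ℤ] M := LinearEquiv.ofFinrankEq _ _ (by
    rw [Module.finrank_prod, hX, hM, two_mul])
  have hs : IsSummand (((⊤ : Submodule ℤ X).prod (⊥ : Submodule ℤ X)).map f.toLinearMap) := by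
    have : IsSummand ((⊤ : Submodule ℤ X).prod (⊥ : Submodule ℤ X)) :=
      IsSummand.prod ⟨⊥, isCompl_top_bot⟩ ⟨⊤, isCompl_bot_top⟩
    have := this.comap f.symm.toLinearMap
    rwa [← Submodule.map_equiv_eq_comap_symm] at this
  obtain ⟨K, hK, -⟩ := exists_isLagrangian_isCompl n h hΛ hs (by
    rw [← (f.submoduleMap _).finrank_eq, (prodSub _ _).finrank_eq, Module.finrank_prod,
      finrank_top, finrank_bot, hX, add_zero]) hM
  exact ⟨K, hK⟩

/-- A primitive vector with trivial quadratic refinement lies in a Lagrangian. -/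
theorem exists_isLagrangian_mem {n : ℕ} {M : Type} [AddCommGroup M] [Module.Free ℤ M]
    [Module.Finite ℤ M] {ψ : Q (-1) M} {Λ : Set M} (h : Nonsingular ψ)
    (hΛ : IsModTwoLagrangian ψ Λ) (hM : Module.finrank ℤ M = 2 * n) {x : M} (hx : Primitive x)
    (hq : Q.quad ψ x = 0) : ∃ K, IsLagrangian ψ K ∧ x ∈ K := by
  obtain ⟨N, _, _, _, ψ', φ, h', hφ, rfl⟩ := h.exists_plane_splitting hx hq
  have h2 := finrank_plane_prod φ
  have hΛ' := hΛ.pullback φ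
  rw [hφ] at hΛ'
  obtain ⟨K, hK⟩ := exists_isLagrangian (n := n - 1) h' hΛ'.of_plane_sum (by omega)
  exact ⟨_, hK.map_plane_prod hφ, ((1, 0), 0), ⟨mem_planeL.2 rfl, K.zero_mem⟩, rfl⟩

end Complement

/-! ### Classes of quasi-formations in the `l`-monoid -/

theorem LMonoid.add_zero {ε : ℤˣ} (a : LMonoid ε) : a + 0 = a :=
  AddMonoid.add_zero (M := LMonoid ε) a

theorem LMonoid.zero_add {ε : ℤˣ} (a : LMonoid ε) : 0 + a = a :=
  AddMonoid.zero_add (M := LMonoid ε) a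

namespace QuasiFormation

variable {ε : ℤˣ}

theorem toL_sum (x y : QuasiFormation ε) : (x.sum y).toL = x.toL + y.toL := rfl

theorem Iso.toL_eq {x y : QuasiFormation ε} (h : Iso x y) : x.toL = y.toL :=
  congrArg (fun a : IsoClass ε => (((a : StableClass ε)) : LMonoid ε)) (Quotient.sound h)

theorem toL_trivialFormation (P : Type) [AddCommGroup P] [Module.Free ℤ P] [Module.Finite ℤ P] :
    (trivialFormation ε P).toL = 0 := by
  have : (trivialFormation ε P).stableClass = 0 := by
    refine (AddCon.eq _).2 ⟨PUnit, P, inferInstance, inferInstance, inferInstance,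
      inferInstance, inferInstance, inferInstance, ?_⟩
    rw [add_comm]
    rfl
  rw [toL, this]
  rfl

theorem toL_formation_add (x : QuasiFormation ε) (K : Submodule ℤ x.M)
    (hK : IsLagrangian x.ψ K) :
    (x.formation K hK).toL + x.toL = (x.replaceL K hK).toL :=
  (AddCon.eq _).2 (AddConGen.Rel.of _ _ (Shift.shift x K hK))

end QuasiFormation

/-! ### Complementary Lagrangians -/

theorem IsLagrangian.exists_isCompl {M : Type} [AddCommGroup M] [Module.Free ℤ M]
    [Module.Finite ℤ M] {ψ : Q (-1) M} {L : Submodule ℤ M} (h : Nonsingular ψ)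
    (hL : IsLagrangian ψ L) : ∃ K, IsLagrangian ψ K ∧ IsCompl L K := by
  obtain ⟨K, hK, hc⟩ := exists_isLagrangian_isCompl _ h (hL.isModTwoLagrangian h) hL.summand rfl
    (hL.half_rank h).symm
  exact ⟨K, hK, hc.symm⟩

/-- Complementary Lagrangians identify a form with a hyperbolic form. -/
theorem IsLagrangian.exists_hyperbolic_isometry {M : Type} [AddCommGroup M] [Module.Free ℤ M]
    [Module.Finite ℤ M] {ψ : Q (-1) M} {L K : Submodule ℤ M} (h : Nonsingular ψ)
    (hL : IsLagrangian ψ L) (hK : IsLagrangian ψ K) (hc : IsCompl L K) :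
    ∃ f : M ≃ₗ[ℤ] L × Module.Dual ℤ L, Q.pullback f.toLinearMap (hyperbolic (-1) L) = ψ ∧
      L.map f.toLinearMap = hypL L ∧ K.map f.toLinearMap = hypR L := by
  -- The form identifies K with L^*: a vector goes to its L-component and its pairing with L.
  let f₀ : M →ₗ[ℤ] L × Module.Dual ℤ L :=
    (L.projectionOnto K hc).prod (Module.Dual.transpose L.subtype ∘ₗ Q.symm ψ)
  have hf₁ : ∀ x, (f₀ x).1 = L.projectionOnto K hc x := fun _ => rfl
  have hf₂ : ∀ x (l : L), (f₀ x).2 l = Q.symm ψ x l := fun _ _ => rfl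
  have hbij : Function.Bijective f₀ := by
    constructor
    · rw [injective_iff_map_eq_zero]
      intro x hx
      have h1 : x ∈ K := by
        rw [← Submodule.projectionOnto_apply_eq_zero_iff hc, ← hf₁, hx]
        rfl
      have h2 : x ∈ L := hL.mem fun y hy => by
        rw [show Q.symm ψ x y = (f₀ x).2 ⟨y, hy⟩ from rfl, hx]
        rfl
      exact Submodule.disjoint_def.1 hc.disjoint x h2 h1
    · rintro ⟨l, g⟩
      obtain ⟨m, hm⟩ := h.exists_symm_eq_on hL.summand g
      -- Changing the L-component of m does not alter its pairing with L.
      refine ⟨m - (L.projectionOnto K hc m : M) + l, Prod.ext ?_ (LinearMap.ext fun y => ?_)⟩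
      · rw [hf₁, map_add, map_sub, Submodule.projectionOnto_apply_left,
          Submodule.projectionOnto_apply_left, sub_self, zero_add]
      · rw [hf₂, map_add, map_sub, LinearMap.add_apply, LinearMap.sub_apply, hm,
          hL.symm_eq_zero (Subtype.property _) y.2, hL.symm_eq_zero l.2 y.2]
        simp
  have hdec : ∀ x, ∃ l ∈ L, ∃ k ∈ K, x = l + k ∧ ((f₀ x).1 : M) = l := fun x =>
    ⟨L.projectionOnto K hc x, Subtype.property _, K.projectionOnto L hc.symm x,
      Subtype.property _, (Submodule.projection_add_projection_eq_self hc x).symm, rfl⟩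
  refine ⟨LinearEquiv.ofBijective f₀ hbij, ?_, ?_, ?_⟩
  · refine Q.pullback_eq_of_symm_quad _ _ _ (fun x y => ?_) fun x => ?_
    · obtain ⟨l, hl, k, hk, hx, hxl⟩ := hdec x
      obtain ⟨l', hl', k', hk', hy, hyl⟩ := hdec y
      change Q.symm (hyperbolic (-1) L) (f₀ x) (f₀ y) = _
      rw [symm_hyperbolic, hf₂, hf₂, hxl, hyl, hx, hy]
      simp only [map_add, LinearMap.add_apply, hL.symm_eq_zero hl hl', hL.symm_eq_zero hl' hl,
        hK.symm_eq_zero hk hk', Q.symm_neg_swap ψ k' l]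
      simp
    · obtain ⟨l, hl, k, hk, hx, hxl⟩ := hdec x
      change (((f₀ x).2 (f₀ x).1 : ℤ) : ZMod 2) = _
      rw [hf₂, hxl, hx, map_add, LinearMap.add_apply, Q.symm_self, Q.quad_add,
        hL.quad_eq_zero hl, hK.quad_eq_zero hk, Q.symm_neg_swap ψ k l]
      simp [ZMod.neg_eq_self_mod_two]
  · ext ⟨l, g⟩
    constructor
    · rintro ⟨x, hx, hxl⟩
      refine ⟨trivial, ?_⟩
      change g = 0
      change f₀ x = _ at hxl
      ext y
      rw [show g y = (f₀ x).2 y by rw [hxl], hf₂, hL.symm_eq_zero hx y.2, LinearMap.zero_apply]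
    · rintro ⟨-, hg⟩
      obtain rfl : g = 0 := hg
      refine ⟨l, l.2, Prod.ext ?_ (LinearMap.ext fun y => hL.symm_eq_zero l.2 y.2)⟩
      exact Submodule.projectionOnto_apply_left hc l
  · ext ⟨l, g⟩
    constructor
    · rintro ⟨x, hx, hxl⟩
      refine ⟨?_, trivial⟩
      change l = 0
      change f₀ x = _ at hxl
      rw [show l = (f₀ x).1 by rw [hxl], hf₁, Submodule.projectionOnto_apply_eq_zero_iff]
      exact hx
    · rintro ⟨hl, -⟩
      obtain rfl : l = 0 := hl
      obtain ⟨x, hx⟩ := hbij.2 (0, g)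
      refine ⟨x, ?_, hx⟩
      have : L.projectionOnto K hc x = 0 := by rw [← hf₁, hx]
      exact (Submodule.projectionOnto_apply_eq_zero_iff hc).1 this

/-! ### Pairs of Lagrangians -/

section Null

variable {M : Type} [AddCommGroup M] [Module.Free ℤ M] [Module.Finite ℤ M]

/-- The formation `(M, ψ; L, K)` has trivial class. -/
def IsNull (ψ : Q (-1) M) (L K : Submodule ℤ M) : Prop :=
  ∃ (h : Nonsingular ψ) (hL : IsLagrangian ψ L) (hK : IsLagrangian ψ K),
    (QuasiFormation.mk M ψ h L hL K hK.summand (hK.half_rank h)).toL = 0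

variable {ψ : Q (-1) M} {L K J : Submodule ℤ M}

theorem IsNull.of_isCompl (h : Nonsingular ψ) (hL : IsLagrangian ψ L) (hK : IsLagrangian ψ K)
    (hc : IsCompl L K) : IsNull ψ L K := by
  refine ⟨h, hL, hK, ?_⟩
  obtain ⟨f, hf⟩ := hL.exists_hyperbolic_isometry h hK hc
  rw [← QuasiFormation.toL_trivialFormation (ε := -1) L]
  exact QuasiFormation.Iso.toL_eq ⟨f, hf⟩

/-- The shift relation reads [L, K] + [K, J] = [L, J]. -/
theorem IsNull.trans (h₁ : IsNull ψ L K) (h₂ : IsNull ψ K J) : IsNull ψ L J := by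
  obtain ⟨h, hL, hK, h₁⟩ := h₁
  obtain ⟨_, _, hJ, h₂⟩ := h₂
  refine ⟨h, hL, hJ, ?_⟩
  have := QuasiFormation.toL_formation_add
    (QuasiFormation.mk M ψ h K hK J hJ.summand (hJ.half_rank h)) L hL
  rw [h₂, LMonoid.add_zero] at this
  exact this.symm.trans h₁

/-- Pass to a complementary Lagrangian and back. -/
theorem IsNull.refl (h : Nonsingular ψ) (hL : IsLagrangian ψ L) : IsNull ψ L L := by
  obtain ⟨K, hK, hc⟩ := hL.exists_isCompl h
  exact (IsNull.of_isCompl h hL hK hc).trans (IsNull.of_isCompl h hK hL hc.symm)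

theorem IsNull.prod {N : Type} [AddCommGroup N] [Module.Free ℤ N] [Module.Finite ℤ N]
    {ψ' : Q (-1) N} {L' K' : Submodule ℤ N} (h₁ : IsNull ψ L K) (h₂ : IsNull ψ' L' K') :
    IsNull (Q.sum ψ ψ') (L.prod L') (K.prod K') := by
  obtain ⟨h, hL, hK, h₁⟩ := h₁
  obtain ⟨h', hL', hK', h₂⟩ := h₂
  refine ⟨nonsingular_sum h h', hL.prod hL', hK.prod hK', ?_⟩
  have := QuasiFormation.toL_sum
    (QuasiFormation.mk M ψ h L hL K hK.summand (hK.half_rank h))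
    (QuasiFormation.mk N ψ' h' L' hL' K' hK'.summand (hK'.half_rank h'))
  rw [h₁, h₂, LMonoid.add_zero] at this
  exact this

theorem IsNull.map {N : Type} [AddCommGroup N] [Module.Free ℤ N] [Module.Finite ℤ N]
    {ψ' : Q (-1) N} (h' : Nonsingular ψ') (f : M ≃ₗ[ℤ] N)
    (h₁ : IsNull (Q.pullback f.toLinearMap ψ') L K) :
    IsNull ψ' (L.map f.toLinearMap) (K.map f.toLinearMap) := by
  obtain ⟨h, hL, hK, h₁⟩ := h₁
  refine ⟨h', hL.map f, hK.map f, ?_⟩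
  rw [← h₁]
  exact (QuasiFormation.Iso.toL_eq ⟨f, rfl, rfl, rfl⟩).symm

/-- In the shift relation [K, L] + [L, V] = [K, V] the first term vanishes, so the Lagrangian of a
quasi-formation can be exchanged. -/
theorem IsNull.toL_eq {x : QuasiFormation (-1)} {K : Submodule ℤ x.M} (hK : IsLagrangian x.ψ K)
    (h : IsNull x.ψ K x.L) : (x.replaceL K hK).toL = x.toL := by
  obtain ⟨_, _, _, h⟩ := h
  rw [← x.toL_formation_add K hK]
  exact (congrArg (· + x.toL) h).trans (LMonoid.zero_add _)

end Null

/-! ### Any two Lagrangians form a formation with trivial class -/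

section Euclid

/-- Division by 2b with balanced remainder. Quotients must be even because a dual vector of x keeps
refinement 0 only under even multiples of x; the price is that the remainder may equal b in absolute
value. -/
theorem exists_natAbs_sub_two_mul_le (a b : ℤ) (hb : b ≠ 0) :
    ∃ k : ℤ, (a - 2 * k * b).natAbs ≤ b.natAbs := by
  have hpos : 0 < 2 * b.natAbs := by omega
  have h1 := Int.le_bmod (x := a) hpos
  have h2 := Int.bmod_lt (x := a) hpos
  have h3 := Int.bmod_eq_self_sub_mul_bdiv a (2 * b.natAbs)
  rcases Int.natAbs_eq b with hb' | hb'
  · refine ⟨a.bdiv (2 * b.natAbs), ?_⟩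
    have : a - 2 * a.bdiv (2 * b.natAbs) * b = a.bmod (2 * b.natAbs) := by
      rw [h3, Nat.cast_mul, Nat.cast_ofNat]
      linear_combination (-2 * a.bdiv (2 * b.natAbs)) * hb'
    rw [this]
    omega
  · refine ⟨-a.bdiv (2 * b.natAbs), ?_⟩
    have : a - 2 * -a.bdiv (2 * b.natAbs) * b = a.bmod (2 * b.natAbs) := by
      rw [h3, Nat.cast_mul, Nat.cast_ofNat]
      linear_combination (2 * a.bdiv (2 * b.natAbs)) * hb'
    rw [this]
    omega

variable {M : Type} [AddCommGroup M] [Module.Free ℤ M] [Module.Finite ℤ M] {ψ : Q (-1) M}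

theorem isLagrangian_span_of_dual {x z : M} (hx : IsLagrangian ψ (ℤ ∙ x))
    (hxz : Q.symm ψ x z = 1) (hz : Q.quad ψ z = 0) :
    IsLagrangian ψ (ℤ ∙ z) ∧ IsCompl (ℤ ∙ x) (ℤ ∙ z) := by
  -- The difference is orthogonal to x, hence a multiple of x.
  have hdec : ∀ m, ∃ c : ℤ, m = c • x + Q.symm ψ x m • z := fun m => by
    have : m - Q.symm ψ x m • z ∈ (ℤ ∙ x) := hx.mem fun y hy => by
      obtain ⟨d, rfl⟩ := Submodule.mem_span_singleton.1 hy
      rw [Q.symm_neg_swap]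
      simp [hxz]
    obtain ⟨c, hc⟩ := Submodule.mem_span_singleton.1 this
    exact ⟨c, by rw [hc, sub_add_cancel]⟩
  refine ⟨isLagrangian_of (le_antisymm (fun m hm => ?_) fun m hm => ?_) fun m hm => ?_,
    ?_, ?_⟩
  · obtain ⟨c, hc⟩ := hdec m
    have h0 := hm z (Submodule.mem_span_singleton_self z)
    rw [hc] at h0
    simp only [map_add, map_smul, LinearMap.add_apply, LinearMap.smul_apply, hxz, Q.symm_self,
      smul_eq_mul, mul_one, mul_zero, add_zero] at h0
    rw [hc, h0, zero_smul, zero_add]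
    exact Submodule.smul_mem _ _ (Submodule.mem_span_singleton_self z)
  · obtain ⟨c, rfl⟩ := Submodule.mem_span_singleton.1 hm
    intro y hy
    obtain ⟨d, rfl⟩ := Submodule.mem_span_singleton.1 hy
    simp
  · obtain ⟨c, rfl⟩ := Submodule.mem_span_singleton.1 hm
    rw [Q.quad_smul, hz, mul_zero]
  · rw [Submodule.disjoint_def]
    intro m hm hm'
    obtain ⟨c, rfl⟩ := Submodule.mem_span_singleton.1 hm'
    have := hx.symm_eq_zero (Submodule.mem_span_singleton_self x) hm
    rw [map_smul, hxz, smul_eq_mul, mul_one] at this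
    rw [this, zero_smul]
  · rw [codisjoint_iff, eq_top_iff]
    intro m _
    obtain ⟨c, hc⟩ := hdec m
    exact Submodule.mem_sup.2 ⟨_, Submodule.smul_mem _ c (Submodule.mem_span_singleton_self x), _,
      Submodule.smul_mem _ _ (Submodule.mem_span_singleton_self z), hc.symm⟩

/-- Euclidean algorithm on b, the pairing of x with y. Write y = a' x + b z' with z' dual to x and
q(z') = 0; the lines of x and z' are complementary, and z' pairs with y to -a'. -/
theorem isNull_span (h : Nonsingular ψ) {y : M} (hy : IsLagrangian ψ (ℤ ∙ y))
    (hyp : Primitive y) (n : ℕ) : ∀ x : M, IsLagrangian ψ (ℤ ∙ x) → Primitive x →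
      (Q.symm ψ x y).natAbs ≤ n → IsNull ψ (ℤ ∙ x) (ℤ ∙ y) := by
  have base : ∀ x : M, IsLagrangian ψ (ℤ ∙ x) → Q.symm ψ x y = 0 →
      IsNull ψ (ℤ ∙ x) (ℤ ∙ y) := by
    intro x hx h0
    have h1 : x ∈ (ℤ ∙ y) := hy.mem fun z hz => by
      obtain ⟨c, rfl⟩ := Submodule.mem_span_singleton.1 hz
      rw [map_smul, h0, smul_zero]
    have h2 : y ∈ (ℤ ∙ x) := hx.mem fun z hz => by
      obtain ⟨c, rfl⟩ := Submodule.mem_span_singleton.1 hz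
      rw [map_smul, Q.symm_neg_swap, h0, neg_zero, smul_zero]
    have : (ℤ ∙ x) = ℤ ∙ y := le_antisymm
      ((Submodule.span_singleton_le_iff_mem _ _).2 h1)
      ((Submodule.span_singleton_le_iff_mem _ _).2 h2)
    rw [this]
    exact IsNull.refl h hy
  induction n with
  | zero => exact fun x hx _ h0 => base x hx (by omega)
  | succ n ih =>
    intro x hx hxp hn
    by_cases hb : Q.symm ψ x y = 0
    · exact base x hx hb
    obtain ⟨z, hz, hzq⟩ := h.exists_hyperbolic_pair hxp
      (hx.quad_eq_zero (Submodule.mem_span_singleton_self x))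
    have hmem : y - Q.symm ψ x y • z ∈ (ℤ ∙ x) := hx.mem fun w hw => by
      obtain ⟨d, rfl⟩ := Submodule.mem_span_singleton.1 hw
      rw [Q.symm_neg_swap]
      simp [hz]
    obtain ⟨a, ha⟩ := Submodule.mem_span_singleton.1 hmem
    obtain ⟨k, hk⟩ := exists_natAbs_sub_two_mul_le a _ hb
    set b := Q.symm ψ x y with hbdef
    set a' := a - 2 * k * b with ha'
    -- Replacing z by z + 2k x turns the coefficient a of x in y into a - 2k b.
    let z' := z + (2 : ℤ) • (k • x)
    have hz' : Q.symm ψ x z' = 1 := by simp [z', hz]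
    have hzq' : Q.quad ψ z' = 0 := by rw [Q.quad_add_two_smul, hzq]
    have hy' : y = a' • x + b • z' := by
      have : y = a • x + b • z := by rw [ha, sub_add_cancel]
      rw [this]
      simp only [ha', z']
      module
    have hzy : Q.symm ψ z' y = -a' := by
      rw [hy', map_add, map_smul, map_smul, Q.symm_neg_swap ψ z' x, hz', Q.symm_self]
      simp
    obtain ⟨hzL, hc⟩ := isLagrangian_span_of_dual hx hz' hzq'
    refine (IsNull.of_isCompl h hx hzL hc).trans (ih z' hzL (primitive_of_symm_eq_one hz') ?_)
    rw [hzy, Int.natAbs_neg]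
    -- If |a'| = |b|, then b divides the primitive vector y, so both coefficients are ±1 and q(y) =
    -- a'b is 1 modulo 2, whereas y spans a Lagrangian.
    suffices a'.natAbs ≠ b.natAbs by omega
    intro heq
    have hdvd : b ∣ a' := Int.natAbs_dvd_natAbs.1 (heq ▸ dvd_rfl)
    obtain ⟨g, hg⟩ := hyp
    have hb1 : b ∣ 1 := by
      rw [← hg, hy', map_add, map_smul, map_smul]
      exact dvd_add (hdvd.mul_right _) (dvd_mul_right _ _)
    have hq := hy.quad_eq_zero (Submodule.mem_span_singleton_self y)
    rw [hy', Q.quad_add, Q.quad_smul, Q.quad_smul, hzq',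
      hx.quad_eq_zero (Submodule.mem_span_singleton_self x), map_smul, map_smul,
      LinearMap.smul_apply, hz', mul_zero, mul_zero, zero_add, zero_add,
      ZMod.intCast_zmod_eq_zero_iff_dvd] at hq
    have hb2 := Int.isUnit_iff.1 (isUnit_of_dvd_one hb1)
    have ha2 : a' = 1 ∨ a' = -1 := by omega
    simp only [smul_eq_mul, mul_one] at hq
    rcases hb2 with h1 | h1 <;> rcases ha2 with h2 | h2 <;> rw [h1, h2] at hq <;>
      revert hq <;> decide

theorem exists_eq_span_of_finrank_eq_one {L : Submodule ℤ M} (hL : IsSummand L)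
    (h1 : Module.finrank ℤ L = 1) : ∃ x, Primitive x ∧ L = ℤ ∙ x := by
  let b := Module.finBasisOfFinrankEq ℤ L h1
  obtain ⟨g, hg⟩ := exists_extension hL (b.coord 0)
  refine ⟨b 0, ⟨g, by rw [hg]; simp⟩, le_antisymm (fun x hx => ?_) ?_⟩
  · have := b.sum_repr ⟨x, hx⟩
    rw [Fin.sum_univ_one] at this
    exact Submodule.mem_span_singleton.2 ⟨_, congrArg Subtype.val this⟩
  · rw [Submodule.span_singleton_le_iff_mem]
    exact (b 0).2

theorem isNull_of_finrank_eq_two (h : Nonsingular ψ) (hM : Module.finrank ℤ M = 2)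
    {L K : Submodule ℤ M} (hL : IsLagrangian ψ L) (hK : IsLagrangian ψ K) : IsNull ψ L K := by
  have h1 := hL.half_rank h
  have h2 := hK.half_rank h
  obtain ⟨x, hx, rfl⟩ := exists_eq_span_of_finrank_eq_one hL.summand (by omega)
  obtain ⟨y, hy, rfl⟩ := exists_eq_span_of_finrank_eq_one hK.summand (by omega)
  exact isNull_span h hK hy _ x hL hx le_rfl

end Euclid

/-! ### Arbitrary rank, by sharing vectors -/

section Induction

variable {M : Type} [AddCommGroup M] [Module.Free ℤ M] [Module.Finite ℤ M] {ψ : Q (-1) M}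

theorem IsLagrangian.comap {M N : Type} [AddCommGroup M] {ψ : Q (-1) M} [AddCommGroup N]
    [Module.Free ℤ N] [Module.Finite ℤ N]
    {L : Submodule ℤ M} (f : N ≃ₗ[ℤ] M) (h : IsLagrangian ψ L) :
    IsLagrangian (Q.pullback f.toLinearMap ψ) (L.comap f.toLinearMap) := by
  have h0 : Q.pullback f.symm.toLinearMap (Q.pullback f.toLinearMap ψ) = ψ := by
    rw [Q.pullback_pullback]
    simp
  have := IsLagrangian.map (ψ := Q.pullback f.toLinearMap ψ) (L := L) f.symm (h0.symm ▸ h)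
  rwa [Submodule.map_equiv_eq_comap_symm, LinearEquiv.symm_symm] at this

/-- Orthogonality to the first basis vector kills the second plane coordinate, and multiples of that
vector clear the first. -/
theorem IsLagrangian.eq_plane_prod {L : Submodule ℤ ((ℤ × ℤ) × M)}
    (h : IsLagrangian (Q.sum plane ψ) L) (he : ((1, 0), 0) ∈ L) :
    ∃ K, IsLagrangian ψ K ∧ L = planeL.prod K := by
  have hL : L = planeL.prod (L.comap (LinearMap.inr ℤ (ℤ × ℤ) M)) := by
    have ha : ∀ a : ℤ, ((a, 0), 0) ∈ L := fun a => by simpa using L.smul_mem a he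
    ext ⟨⟨a, b⟩, m⟩
    constructor
    · intro hx
      obtain rfl : b = 0 := by simpa using h.symm_eq_zero he hx
      refine ⟨mem_planeL.2 rfl, ?_⟩
      have := L.sub_mem hx (ha a)
      simpa using this
    · rintro ⟨hb, hm⟩
      obtain rfl : b = 0 := mem_planeL.1 hb
      have := L.add_mem (ha a) hm
      simpa using this
  refine ⟨_, isLagrangian_of (le_antisymm (fun m hm => ?_) fun m hm y hy => ?_) fun m hm => ?_, hL⟩
  · refine h.mem fun y hy => ?_
    rw [hL] at hy
    simpa using hm _ hy.2
  · simpa using h.symm_eq_zero hm hy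
  · simpa using h.quad_eq_zero hm

/-- Split off a plane with x as first basis vector. Both Lagrangians become `planeL` plus a
Lagrangian of the smaller form, where `ih` applies. -/
theorem isNull_of_mem {n : ℕ} (ih : ∀ {N : Type} [AddCommGroup N] [Module.Free ℤ N]
      [Module.Finite ℤ N] {ψ : Q (-1) N} {L K : Submodule ℤ N}, Nonsingular ψ →
      Module.finrank ℤ N = 2 * n → IsLagrangian ψ L → IsLagrangian ψ K → IsNull ψ L K)
    (h : Nonsingular ψ) (hM : Module.finrank ℤ M = 2 * (n + 1)) {L K : Submodule ℤ M}
    (hL : IsLagrangian ψ L) (hK : IsLagrangian ψ K) {x : M} (hx : Primitive x) (hxL : x ∈ L)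
    (hxK : x ∈ K) : IsNull ψ L K := by
  obtain ⟨N, _, _, _, ψ', φ, h', hφ, rfl⟩ := h.exists_plane_splitting hx (hL.quad_eq_zero hxL)
  have h2 := finrank_plane_prod φ
  have hL' := hL.comap φ
  have hK' := hK.comap φ
  rw [hφ] at hL' hK'
  obtain ⟨L₁, hL₁, hL⟩ := hL'.eq_plane_prod hxL
  obtain ⟨K₁, hK₁, hK⟩ := hK'.eq_plane_prod hxK
  have := (IsNull.refl plane_nonsingular planeL_lagrangian).prod (ih h' (by omega) hL₁ hK₁)
  rw [← hL, ← hK, ← hφ] at this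
  have := this.map h φ
  rwa [Submodule.map_comap_eq_of_surjective φ.surjective,
    Submodule.map_comap_eq_of_surjective φ.surjective] at this

/-- Two orthogonal primitive vectors which are incongruent modulo `2` and have trivial quadratic
refinement lie in a common Lagrangian. -/
theorem exists_isLagrangian_mem_mem {n : ℕ} {Λ : Set M} (h : Nonsingular ψ)
    (hΛ : IsModTwoLagrangian ψ Λ) (hM : Module.finrank ℤ M = 2 * (n + 1)) {x y : M}
    (hx : Primitive x) (hxq : Q.quad ψ x = 0) (hy : Primitive y) (hyq : Q.quad ψ y = 0)
    (hxy : Q.symm ψ x y = 0) (hmod : ∀ z, x - (2 : ℤ) • z ≠ y) :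
    ∃ K, IsLagrangian ψ K ∧ x ∈ K ∧ y ∈ K := by
  obtain ⟨N, _, _, _, ψ', φ, h', hφ, rfl⟩ := h.exists_plane_splitting hx hxq
  have h2 := finrank_plane_prod φ
  have hΛ' := hΛ.pullback φ
  rw [hφ] at hΛ'
  obtain ⟨⟨⟨a, b⟩, m⟩, rfl⟩ := φ.surjective y
  have hs := Q.symm_pullback φ.toLinearMap ψ ((1, 0), 0) ((a, b), m)
  have hq := Q.quad_pullback φ.toLinearMap ψ ((a, b), m)
  rw [hφ] at hs hq
  obtain rfl : b = 0 := by
    rw [LinearEquiv.coe_coe, hxy] at hs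
    simpa using hs
  have hm : Q.quad ψ' m = 0 := by
    rw [LinearEquiv.coe_coe, hyq] at hq
    simpa using hq
  suffices ∃ K, IsLagrangian ψ' K ∧ m ∈ K by
    obtain ⟨K, hK, hmK⟩ := this
    exact ⟨_, hK.map_plane_prod hφ, ⟨_, ⟨mem_planeL.2 rfl, K.zero_mem⟩, rfl⟩,
      ⟨_, ⟨mem_planeL.2 rfl, hmK⟩, rfl⟩⟩
  by_cases hm0 : m = 0
  · obtain ⟨K, hK⟩ := exists_isLagrangian (n := n) h' hΛ'.of_plane_sum (by omega)
    exact ⟨K, hK, hm0 ▸ K.zero_mem⟩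
  · obtain ⟨c, m', hc, rfl, hm'⟩ := exists_eq_smul_primitive hm0
    obtain ⟨K, hK, hmK⟩ := exists_isLagrangian_mem (n := n) h' hΛ'.of_plane_sum (by omega) hm' (by
      -- For c even, y is congruent to a x modulo 2: a even contradicts primitivity of y, and a odd
      -- makes x and y congruent. So c is odd and m' inherits refinement 0.
      rcases Int.even_or_odd c with ⟨d, rfl⟩ | ⟨d, rfl⟩
      · exfalso
        have hdec : φ ((a, 0), (d + d) • m') =
            a • φ ((1, 0), 0) + (2 : ℤ) • (d • φ ((0, 0), m')) := by
          rw [← map_smul, ← map_smul, ← map_smul, ← map_add]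
          congr 1
          ext
          · simp
          · simp
          · simp only [Prod.snd_add, Prod.smul_snd, smul_zero, zero_add]
            module
        obtain ⟨g, hg⟩ := hy
        rw [hdec] at hg hmod
        simp only [map_add, map_smul, smul_eq_mul] at hg
        rcases Int.even_or_odd a with ⟨k, rfl⟩ | ⟨k, rfl⟩
        · have : 2 * (k * g (φ ((1, 0), 0)) + d * g (φ ((0, 0), m'))) = 1 := by
            linear_combination hg
          omega
        · refine hmod (-k • φ ((1, 0), 0) - d • φ ((0, 0), m')) ?_
          module
      · rw [Q.quad_smul] at hm
        have h1 : ((2 * d + 1 : ℤ) : ZMod 2) = 1 := by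
          have h2 : (2 : ZMod 2) = 0 := by decide
          push_cast
          rw [h2, zero_mul, zero_add]
        rwa [h1, one_mul] at hm)
    exact ⟨K, hK, K.smul_mem c hmK⟩

/-- If both L and a complementary Lagrangian lay in K + 2M, all of M would pair evenly with K,
although a primitive vector of K has a dual vector. -/
theorem exists_isNull_not_congr (h : Nonsingular ψ) {L K : Submodule ℤ M}
    (hL : IsLagrangian ψ L) (hK : IsLagrangian ψ K) (hK0 : K ≠ ⊥) :
    ∃ L', IsLagrangian ψ L' ∧ IsNull ψ L L' ∧
      ∃ x ∈ L', Primitive x ∧ ∀ y, x - (2 : ℤ) • y ∉ K := by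
  have hprim : ∀ {L' : Submodule ℤ M}, IsLagrangian ψ L' →
      (∃ x ∈ L', ∀ y, x - (2 : ℤ) • y ∉ K) →
      ∃ x ∈ L', Primitive x ∧ ∀ y, x - (2 : ℤ) • y ∉ K := by
    rintro L' hL' ⟨x, hx, hxK⟩
    have hx0 : x ≠ 0 := by
      rintro rfl
      exact hxK 0 (by simp)
    obtain ⟨c, x, hc, rfl, hxp, hxL⟩ := exists_primitive_mem hL'.summand hx hx0
    refine ⟨x, hxL, hxp, fun y hy => hxK (c • y) ?_⟩
    rw [smul_comm, ← smul_sub]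
    exact K.smul_mem c hy
  by_cases h1 : ∃ x ∈ L, ∀ y, x - (2 : ℤ) • y ∉ K
  · exact ⟨L, hL, IsNull.refl h hL, hprim hL h1⟩
  · obtain ⟨L', hL', hc⟩ := hL.exists_isCompl h
    refine ⟨L', hL', IsNull.of_isCompl h hL hL' hc, hprim hL' ?_⟩
    by_contra h2
    push Not at h1 h2
    obtain ⟨u, hu, hu0⟩ := K.ne_bot_iff.1 hK0
    obtain ⟨-, u, -, -, hup, hu⟩ := exists_primitive_mem hK.summand hu hu0
    obtain ⟨m, hm⟩ := h.exists_dual_vector hup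
    obtain ⟨x, hx, x', hx', rfl⟩ := Submodule.mem_sup.1
      (show m ∈ L ⊔ L' by rw [hc.sup_eq_top]; trivial)
    obtain ⟨y, hy⟩ := h1 x hx
    obtain ⟨y', hy'⟩ := h2 x' hx'
    have e1 := hK.symm_eq_zero hy hu
    have e2 := hK.symm_eq_zero hy' hu
    simp only [map_sub, map_add, map_smul, LinearMap.sub_apply, LinearMap.add_apply,
      LinearMap.smul_apply, smul_eq_mul] at e1 e2 hm
    omega

/-- The class of a formation with two Lagrangians is trivial. -/
theorem isNull_of_isLagrangian (n : ℕ) : ∀ {M : Type} [AddCommGroup M] [Module.Free ℤ M]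
    [Module.Finite ℤ M] {ψ : Q (-1) M} {L K : Submodule ℤ M}, Nonsingular ψ →
    Module.finrank ℤ M = 2 * n → IsLagrangian ψ L → IsLagrangian ψ K → IsNull ψ L K := by
  induction n with
  | zero =>
    intro M _ _ _ ψ L K h hM hL hK
    have : Subsingleton M := Module.finrank_zero_iff.1 hM
    rw [Subsingleton.elim K L]
    exact IsNull.refl h hL
  | succ n ih =>
    intro M _ _ _ ψ L K h hM hL hK
    have hKr := hK.half_rank h
    rcases Nat.eq_zero_or_pos n with rfl | hn
    · exact isNull_of_finrank_eq_two h hM hL hK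
    have hK0 : K ≠ ⊥ := by
      rintro rfl
      rw [finrank_bot] at hKr
      omega
    obtain ⟨L', hL', hLL', x, hx, hxp, hxK⟩ := exists_isNull_not_congr h hL hK hK0
    -- K has rank at least 2 here, so the functional on it given by x has a kernel.
    have hker : ∃ y ∈ K, y ≠ 0 ∧ Q.symm ψ x y = 0 := by
      by_contra! hall
      have hinj : Function.Injective (Q.symm ψ x ∘ₗ K.subtype) := by
        rw [injective_iff_map_eq_zero]
        rintro ⟨y, hy⟩ h0
        by_contra hne
        exact hall y hy (fun h => hne (Subtype.ext h)) h0
      have := LinearMap.finrank_le_finrank_of_injective hinj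
      rw [Module.finrank_self] at this
      omega
    obtain ⟨y, hy, hy0, hxy⟩ := hker
    obtain ⟨c, y, hc, rfl, hyp, hyK⟩ := exists_primitive_mem hK.summand hy hy0
    rw [map_smul, smul_eq_mul] at hxy
    -- J shares x with L' and y with K. Incongruence holds because x is congruent modulo 2 to no
    -- vector of K.
    obtain ⟨J, hJ, hxJ, hyJ⟩ := exists_isLagrangian_mem_mem h (hL.isModTwoLagrangian h) hM hxp
      (hL'.quad_eq_zero hx) hyp (hK.quad_eq_zero hyK) ((mul_eq_zero.1 hxy).resolve_left hc)
      fun z hz => hxK z (hz ▸ hyK)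
    exact hLL'.trans ((isNull_of_mem ih h hM hL' hJ hxp hx hxJ).trans
      (isNull_of_mem ih h hM hJ hK hyp hyJ hyK))

end Induction

/-! ### Quasi-formations are classified by the form on `V` -/

namespace QuasiFormation

/-- The class of a quasi-formation does not depend on its Lagrangian. -/
theorem toL_eq_of_isometry {x y : QuasiFormation (-1)} (f : x.M ≃ₗ[ℤ] y.M)
    (hf : Q.pullback f.toLinearMap y.ψ = x.ψ) (hV : x.V.map f.toLinearMap = y.V) :
    x.toL = y.toL := by
  have hK : IsLagrangian y.ψ (x.L.map f.toLinearMap) := IsLagrangian.map f (hf.symm ▸ x.lagrangian)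
  rw [← (isNull_of_isLagrangian _ y.nonsingular (hK.half_rank y.nonsingular).symm hK
    y.lagrangian).toL_eq hK]
  exact Iso.toL_eq ⟨f, hf, rfl, hV⟩

/-! ### Boundaries of asymmetric forms -/

theorem isometric_restrict_graph {K : Type} [AddCommGroup K] [Module.Free ℤ K] [Module.Finite ℤ K]
    (ψ : Q (-1) (K × Module.Dual ℤ K)) (τ : K →ₗ[ℤ] Module.Dual ℤ K) :
    Form.Isometric ⟨K, Q.pullback (LinearMap.id.prod τ) ψ⟩ (restrict ψ (LinearMap.graph τ)) := by
  let f : K ≃ₗ[ℤ] LinearMap.graph τ :=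
    { toFun := fun x => ⟨(x, τ x), rfl⟩
      invFun := fun x => x.1.1
      map_add' := fun x y => Subtype.ext (by simp)
      map_smul' := fun c x => Subtype.ext (by simp)
      left_inv := fun x => rfl
      right_inv := fun x => Subtype.ext (Prod.ext rfl x.2.symm) }
  exact ⟨f, Q.pullback_pullback _ _ _⟩

variable {K : Type} [AddCommGroup K] [Module.Free ℤ K] [Module.Finite ℤ K]

theorem isometric_formV_boundary (ρ : BilinForm ℤ K) :
    Form.Isometric ⟨K, Q.mk (-1) ρ⟩ (boundary (-1) K ρ).formV := by
  have := isometric_restrict_graph (hyperbolic (-1) K) ρ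
  rwa [hyperbolic, Q.pullback_mk] at this

/-- The pairing of (x, g) with (y, ρ y) is g(y) - ρ(y)(x). -/
theorem annihilator_graph {K : Type} [AddCommGroup K] (ρ : BilinForm ℤ K) :
    annihilator (hyperbolic (-1) K) (LinearMap.graph ρ) = LinearMap.graph ρ.flip := by
  ext ⟨x, g⟩
  rw [LinearMap.mem_graph_iff, mem_annihilator]
  constructor
  · intro h
    refine LinearMap.ext fun y => ?_
    have := h (y, ρ y) rfl
    rw [symm_hyperbolic] at this
    simp only [Units.val_neg, Units.val_one, neg_mul, one_mul] at this
    change g y = ρ y x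
    omega
  · rintro h ⟨y, g'⟩ hy
    obtain rfl : g' = ρ y := hy
    obtain rfl : g = ρ.flip x := h
    rw [symm_hyperbolic]
    simp

/-- The form on the graph of the transpose, negated, is -ρ^t = Tρ, which has the class of ρ. This
puts the image of b on the diagonal. -/
theorem isometric_formVPerp_boundary (ρ : BilinForm ℤ K) :
    Form.Isometric ⟨K, Q.mk (-1) ρ⟩ (boundary (-1) K ρ).formVPerp := by
  have h := isometric_restrict_graph (-hyperbolic (-1) K) ρ.flip
  have h0 : Q.pullback (LinearMap.id.prod ρ.flip) (-hyperbolic (-1) K) = Q.mk (-1) ρ := by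
    rw [map_neg, hyperbolic, Q.pullback_mk, ← map_neg]
    -- (1 - T)(-ρ) = -ρ - ρ^t, the difference of the two representatives.
    refine (Submodule.Quotient.eq _).2 ⟨-ρ, ?_⟩
    ext x y
    simp [duality, hyperbolicPairing]
    ring
  rw [h0, ← annihilator_graph] at h
  exact h

theorem b_boundary (ρ : BilinForm ℤ K) : b (-1) (boundary (-1) K ρ).toL =
    (Form.toFZS ⟨K, Q.mk (-1) ρ⟩, Form.toFZS ⟨K, Q.mk (-1) ρ⟩) := by
  rw [b_toL, Form.toFZS_congr (isometric_formV_boundary ρ).symm,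
    Form.toFZS_congr (isometric_formVPerp_boundary ρ).symm]

/-- Isometric forms have isomorphic boundaries up to the choice of Lagrangian. -/
theorem toL_boundary_eq {K' : Type} [AddCommGroup K'] [Module.Free ℤ K'] [Module.Finite ℤ K']
    {ρ : BilinForm ℤ K} {ρ' : BilinForm ℤ K'}
    (h : Form.Isometric ⟨K, Q.mk (-1) ρ⟩ ⟨K', Q.mk (-1) ρ'⟩) :
    (boundary (-1) K ρ).toL = (boundary (-1) K' ρ').toL := by
  obtain ⟨f, hf⟩ := h
  change K ≃ₗ[ℤ] K' at f
  change Q.pullback f.toLinearMap (Q.mk (-1) ρ') = Q.mk (-1) ρ at hf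
  rw [Q.pullback_mk] at hf
  obtain ⟨σ, hσ⟩ := (Submodule.Quotient.eq _).1 hf
  -- The discrepancy s equals σ + σ^t: it is symmetric with even diagonal.
  let s : BilinForm ℤ K := ρ'.compl₁₂ f.toLinearMap f.toLinearMap - ρ
  have hs : ∀ x y, s x y = ρ' (f x) (f y) - ρ x y := fun _ _ => rfl
  have hsσ : ∀ x y, s x y = σ x y + σ y x := fun x y => by
    have := LinearMap.congr_fun (LinearMap.congr_fun hσ x) y
    rw [show s = _ from rfl, ← this]
    simp [duality]
  -- The shear (x, g) ↦ (x, g + s x) followed by the isometry induced by f. Symmetry of s preserves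
  -- the alternating form, and evenness of its diagonal preserves the refinement.
  let F : (K × Module.Dual ℤ K) ≃ₗ[ℤ] (K' × Module.Dual ℤ K') :=
    { toFun := fun a => (f a.1, (a.2 + s a.1) ∘ₗ f.symm.toLinearMap)
      invFun := fun a => (f.symm a.1, a.2 ∘ₗ f.toLinearMap - s (f.symm a.1))
      map_add' := fun a a' => by
        refine Prod.ext (by simp) (LinearMap.ext fun z => ?_)
        simp
        ring
      map_smul' := fun c a => by
        refine Prod.ext (by simp) (LinearMap.ext fun z => ?_)
        simp
        ring
      left_inv := fun a => by ext <;> simp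
      right_inv := fun a => by ext <;> simp }
  have hF₁ : ∀ a, (F a).1 = f a.1 := fun _ => rfl
  have hF₂ : ∀ a z, (F a).2 (f z) = a.2 z + s a.1 z := fun a z => by simp [F]
  refine toL_eq_of_isometry F ?_ ?_
  · refine Q.pullback_eq_of_symm_quad (M := K' × Module.Dual ℤ K') (N := K × Module.Dual ℤ K)
      F.toLinearMap (hyperbolic (-1) K') (hyperbolic (-1) K) (fun a a' => ?_) fun a => ?_
    · rw [LinearEquiv.coe_coe, symm_hyperbolic, symm_hyperbolic, hF₁, hF₁, hF₂, hF₂, hsσ, hsσ]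
      simp
      ring
    · change (((F a).2 (F a).1 : ℤ) : ZMod 2) = ((a.2 a.1 : ℤ) : ZMod 2)
      rw [hF₁, hF₂, hsσ]
      push_cast
      rw [ZMod.two_add_self, add_zero]
  · change (LinearMap.graph ρ).map F.toLinearMap = LinearMap.graph ρ'
    have hF : ∀ x, F (x, ρ x) = (f x, ρ' (f x)) := fun x => by
      refine Prod.ext rfl (LinearMap.ext fun z => ?_)
      obtain ⟨z, rfl⟩ := f.surjective z
      rw [hF₂, hs]
      simp
    ext ⟨x, g⟩
    constructor
    · rintro ⟨⟨y, g'⟩, hy, he⟩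
      obtain rfl : g' = ρ y := hy
      rw [LinearEquiv.coe_coe, hF] at he
      rw [← he]
      rfl
    · intro hx
      obtain rfl : g = ρ' x := hx
      exact ⟨(f.symm x, ρ (f.symm x)), rfl, by rw [LinearEquiv.coe_coe, hF]; simp⟩

/-! ### Elementary representatives and injectivity -/

theorem exists_eq_graph {K : Type} [AddCommGroup K] {V : Submodule ℤ (K × Module.Dual ℤ K)} (h : IsCompl V (hypR K)) :
    ∃ ρ : BilinForm ℤ K, V = LinearMap.graph ρ := by
  refine Submodule.exists_eq_graph ⟨?_, fun x => ?_⟩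
  · rintro ⟨⟨x, g⟩, hx⟩ ⟨⟨y, g'⟩, hy⟩ hxy
    obtain rfl : x = y := hxy
    have := Submodule.disjoint_def.1 h.disjoint _ (V.sub_mem hx hy) ⟨by simp, trivial⟩
    exact Subtype.ext (sub_eq_zero.1 this)
  · obtain ⟨v, hv, w, hw, hvw⟩ := Submodule.mem_sup.1
      (show (x, (0 : Module.Dual ℤ K)) ∈ V ⊔ hypR K by rw [h.sup_eq_top]; trivial)
    refine ⟨⟨v, hv⟩, ?_⟩
    have h1 := congrArg Prod.fst hvw
    have h2 : w.1 = 0 := hw.1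
    simpa [h2] using h1

/-- A Lagrangian J complementary to V and a Lagrangian K complementary to J identify M with H(K) and
J with K^*; then V, being complementary to K^*, is a graph. The given Lagrangian is simply exchanged
for K. -/
theorem exists_boundary (x : QuasiFormation (-1)) :
    ∃ (K : Type) (_ : AddCommGroup K) (_ : Module.Free ℤ K) (_ : Module.Finite ℤ K)
      (ρ : BilinForm ℤ K), (boundary (-1) K ρ).toL = x.toL ∧
      Form.Isometric ⟨K, Q.mk (-1) ρ⟩ x.formV := by
  obtain ⟨J, hJ, hJV⟩ := exists_isLagrangian_isCompl _ x.nonsingular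
    (x.lagrangian.isModTwoLagrangian x.nonsingular) x.summand rfl x.half_rank.symm
  obtain ⟨K, hK, hJK⟩ := hJ.exists_isCompl x.nonsingular
  obtain ⟨f, hf, -, hfJ⟩ := hK.exists_hyperbolic_isometry x.nonsingular hJ hJK.symm
  have hc : IsCompl (x.V.map f.toLinearMap) (hypR K) := by
    rw [← hfJ]
    exact (Submodule.orderIsoMapComap f).isCompl_iff.1 hJV.symm
  obtain ⟨ρ, hρ⟩ := exists_eq_graph hc
  refine ⟨K, inferInstance, inferInstance, inferInstance, ρ,
    (toL_eq_of_isometry (y := boundary (-1) K ρ) f hf hρ).symm,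
    (isometric_formV_boundary ρ).trans (Form.Isometric.symm ?_)⟩
  have := restrict_isometric (hyperbolic (-1) K) f x.V
  rwa [hf, hρ] at this

theorem toL_eq_of_isometric_formV {x y : QuasiFormation (-1)}
    (h : Form.Isometric x.formV y.formV) : x.toL = y.toL := by
  obtain ⟨K, _, _, _, ρ, hρ, hρV⟩ := x.exists_boundary
  obtain ⟨K', _, _, _, ρ', hρ', hρV'⟩ := y.exists_boundary
  rw [← hρ, ← hρ']
  exact toL_boundary_eq ((hρV.trans h).trans hρV'.symm)

/-- Zero-stabilising the form on V is realised by adding a trivial formation, whose class is zero.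
-/
theorem isometric_formV_sum_trivialFormation (x : QuasiFormation (-1)) (P : Type)
    [AddCommGroup P] [Module.Free ℤ P] [Module.Finite ℤ P] :
    Form.Isometric (x.sum (trivialFormation (-1) P)).formV (x.formV.sum (Form.zero (-1) P)) := by
  refine Form.Isometric.trans (restrict_prod x.ψ _ x.V _) (Form.Isometric.sum (.refl _) ?_)
  have hr : Module.finrank ℤ (hypR P) = Module.finrank ℤ P := by
    have h1 := (hypR_lagrangian (ε := -1) (P := P)).half_rank hyperbolic_nonsingular
    have h2 := finrank_hyp (P := P)
    omega
  have : Module.Free ℤ (hypR P) := (restrict (hyperbolic (-1) P) (hypR P)).free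
  -- Both forms vanish, so any linear isomorphism is an isometry and equality of ranks suffices.
  let f : hypR P ≃ₗ[ℤ] P := LinearEquiv.ofFinrankEq (hypR P) P hr
  refine ⟨f, ?_⟩
  refine (map_zero _).trans ?_
  exact (hypR_lagrangian (ε := -1) (P := P)).pullback_eq.symm

theorem toL_sum_trivialFormation (x : QuasiFormation (-1)) (P : Type)
    [AddCommGroup P] [Module.Free ℤ P] [Module.Finite ℤ P] :
    (x.sum (trivialFormation (-1) P)).toL = x.toL := by
  rw [toL_sum, toL_trivialFormation]
  exact LMonoid.add_zero _

theorem toL_eq_of_toFZS_formV {x y : QuasiFormation (-1)}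
    (h : x.formV.toFZS = y.formV.toFZS) : x.toL = y.toL := by
  obtain ⟨P, P', _, _, _, _, _, _, h⟩ := (AddCon.eq _).1 h
  have h' : Form.Isometric (x.formV.sum (Form.zero (-1) P)) (y.formV.sum (Form.zero (-1) P')) :=
    Quotient.exact h
  rw [← x.toL_sum_trivialFormation P, ← y.toL_sum_trivialFormation P']
  exact toL_eq_of_isometric_formV (((x.isometric_formV_sum_trivialFormation P).trans h').trans
    (y.isometric_formV_sum_trivialFormation P').symm)

end QuasiFormation

/-! ### Conclusion -/

theorem LMonoid.exists_toL (a : LMonoid (-1)) : ∃ x : QuasiFormation (-1), x.toL = a := by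
  induction a using AddCon.induction_on with
  | _ a =>
    induction a using AddCon.induction_on with
    | _ a =>
      obtain ⟨x, rfl⟩ := Quotient.exists_rep a
      exact ⟨x, rfl⟩

theorem FZS.exists_toFZS (a : FZS (-1)) : ∃ v : Form (-1), v.toFZS = a := by
  induction a using AddCon.induction_on with
  | _ a =>
    obtain ⟨v, rfl⟩ := Quotient.exists_rep a
    exact ⟨v, rfl⟩

theorem LMonoid.isElementary (a : LMonoid (-1)) : IsElementary a := by
  obtain ⟨x, rfl⟩ := a.exists_toL
  obtain ⟨K, i₁, i₂, i₃, ρ, hρ, -⟩ := x.exists_boundary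
  exact ⟨K, i₁, i₂, i₃, ρ, hρ⟩

theorem bijective_fst_b : Function.Bijective fun a : LMonoid (-1) => (b (-1) a).1 := by
  constructor
  · intro a a' h
    obtain ⟨x, rfl⟩ := a.exists_toL
    obtain ⟨x', rfl⟩ := a'.exists_toL
    exact QuasiFormation.toL_eq_of_toFZS_formV h
  · intro v
    obtain ⟨⟨K, θ⟩, rfl⟩ := FZS.exists_toFZS v
    obtain ⟨ρ, rfl⟩ := Q.mk_surjective θ
    exact ⟨(QuasiFormation.boundary (-1) K ρ).toL,
      congrArg Prod.fst (QuasiFormation.b_boundary ρ)⟩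

end
end Surgery

theorem mainTheorem10 :
    (∀ x : Surgery.LMonoid (-1), Surgery.IsElementary x) ∧
    (∃ e : Surgery.LMonoid (-1) ≃+ Surgery.FZS (-1), ∀ x : Surgery.LMonoid (-1),
      Surgery.b (-1) x = (e x, e x)) := by
  refine ⟨Surgery.LMonoid.isElementary, AddEquiv.ofBijective
    ((AddMonoidHom.fst (Surgery.FZS (-1)) (Surgery.FZS (-1))).comp (Surgery.b (-1)))
    Surgery.bijective_fst_b, fun x => ?_⟩
  refine Prod.ext rfl ?_
  change (Surgery.b (-1) x).2 = (Surgery.b (-1) x).1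
  -- On an elementary representative both components of b are the class of ρ.
  obtain ⟨K, _, _, _, ρ, rfl⟩ := Surgery.LMonoid.isElementary x
  rw [Surgery.QuasiFormation.b_boundary]
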